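/- **Setting.** Let $k_i,c_i>0$ ($i=1,2,3$), $\rho,\ell_1,\ell_2>0$, $B>C>D$, and put $\alpha_i=\frac{k_i}{\rho c_i}$, $\delta_i=\rho\ell_i$; assume $\alpha_2>\alpha_3$. The three-phase Stefan problem asks for free boundaries $0<y_2(t)<y_1(t)$ ($t>0$), continuous on $[0,\infty)$, with $y_1(0)=y_2(0)=0$, and temperatures $\Phi_3,\Phi_2,\Phi_1$ on $0\le x\le y_2(t)$, $y_2(t)\le x\le y_1(t)$, $x\ge y_1(t)$ ($t>0$) respectively, continuous there, such that $\partial_t\Phi_i=\alpha_i\,\partial_x^2\Phi_i$ classically in the interior of the $i$-th phase and, for $t>0$, $$\Phi_3(y_2(t),t)=\Phi_2(y_2(t),t)=B,\qquad \Phi_2(y_1(t),t)=\Phi_1(y_1(t),t)=C,$$ $$\lim_{t\to0^+}\Phi_1(x,t)=D\ (x>0),\qquad \lim_{x\to\infty}\Phi_1(x,t)=D,$$ $$k_2\,\partial_x\Phi_2(y_2(t),t)-k_3\,\partial_x\Phi_3(y_2(t),t)=\delta_2\,\dot y_2(t),\qquad k_1\,\partial_x\Phi_1(y_1(t),t)-k_2\,\partial_x\Phi_2(y_1(t),t)=\delta_1\,\dot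 y_1(t),$$ with one-sided space derivatives. (P2), with datum $A>B$, is this problem with $\Phi_3(0,t)=A$ for $t>0$; (P3), with datum $q_0>0$, is this problem with $k_3\,\partial_x\Phi_3(0,t)=-q_0/\sqrt t$ for $t>0$. Solutions are understood to be of similarity type: $\Phi_i(x,t)$ depends only on $x/(2\sqrt{\alpha_i t})$ and $y_i(t)=2\xi_i\sqrt{\alpha_1t}$ with constants $\xi_i$. Let $\mathrm{Ste}_1=\frac{c_1(C-D)}{\ell_1}$, $\mathrm{Ste}_2=\frac{c_2(B-C)}{\ell_2}$ and, for $z\ge0$, $$\varphi(z)=z+\frac{\mathrm{Ste}_1}{\sqrt\pi}\frac{e^{-z^2}}{\operatorname{erfc}(z)},\qquad H(z)=\operatorname{erf}\Big(z\sqrt{\tfrac{\alpha_1}{\alpha_2}}\Big)-\frac{\mathrm{Ste}_2}{\sqrt\pi}\frac{\ell_2}{\ell_1}\sqrt{\frac{k_2c_1}{k_1c_2}}\,\frac{e^{-z^2\alpha_1/\alpha_2}}{\varphi(z)},\qquad Q(z)=\frac{\ell_1}{\ell_2}\varphi(z)e^{z^2\alpha_1/\alpha_2},$$ let $z_0=H^{-1}(0)>0$,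 and put $$q_2=\frac{k_2(B-C)}{\sqrt{\pi\alpha_2}\,\operatorname{erf}\big(z_0\sqrt{\alpha_1/\alpha_2}\big)},\qquad \iota(z)=\sqrt{\tfrac{\alpha_2}{\alpha_1}}\operatorname{erf}^{-1}(H(z))\quad(z>z_0),$$ $$V_A(z)=\frac{A-B}{\ell_2}\sqrt{\frac{c_1c_3k_3}{\pi k_1}}\,\frac{e^{-z^2(\alpha_1/\alpha_3-\alpha_1/\alpha_2)}}{\operatorname{erf}\big(z\sqrt{\alpha_1/\alpha_3}\big)}-ze^{z^2\alpha_1/\alpha_2},\qquad P_{q_0}(z)=e^{z^2\alpha_1/\alpha_2}\Big[-z+\frac{q_0}{\ell_2}\sqrt{\frac{c_1}{\rho k_1}}\,e^{-z^2\alpha_1/\alpha_3}\Big].$$ For $A>B$ let $\mu_1$ be the unique solution of $Q(z)=V_A(\iota(z))$, $z>z_0$, and $\mu_2=\iota(\mu_1)$; for $q_0>q_2$ let $\lambda_1$ be the unique solution of $Q(z)=P_{q_0}(\iota(z))$, $z>z_0$, and $\lambda_2=\iota(\lambda_1)$. Denote by $(u_1,u_2,u_3,r_1,r_2)$ the functions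 $$u_3=A\,\frac{\operatorname{erf}(\mu_2\sqrt{\alpha_1/\alpha_3})-\operatorname{erf}(\frac{x}{2\sqrt{\alpha_3t}})}{\operatorname{erf}(\mu_2\sqrt{\alpha_1/\alpha_3})}+B\,\frac{\operatorname{erf}(\frac{x}{2\sqrt{\alpha_3t}})}{\operatorname{erf}(\mu_2\sqrt{\alpha_1/\alpha_3})},$$ $$u_2=\frac{(C-B)\operatorname{erf}(\frac{x}{2\sqrt{\alpha_2t}})-C\operatorname{erf}(\mu_2\sqrt{\alpha_1/\alpha_2})+B\operatorname{erf}(\mu_1\sqrt{\alpha_1/\alpha_2})}{\operatorname{erf}(\mu_1\sqrt{\alpha_1/\alpha_2})-\operatorname{erf}(\mu_2\sqrt{\alpha_1/\alpha_2})},$$ $$u_1=D+(C-D)\frac{\operatorname{erfc}(\frac{x}{2\sqrt{\alpha_1t}})}{\operatorname{erfc}(\mu_1)},\qquad r_i=2\mu_i\sqrt{\alpha_1t},$$ and by $(\theta_1,\theta_2,\theta_3,s_1,s_2)$ the functions $$\theta_3=B+\frac{q_0\sqrt{\pi\alpha_3}}{k_3}\Big(\operatorname{erf}(\lambda_2\sqrt{\tfrac{\alpha_1}{\alpha_3}})-\operatorname{erf}(\tfrac{x}{2\sqrt{\alpha_3t}})\Big),$$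 $$\theta_2=C+(B-C)\frac{\operatorname{erf}(\lambda_1\sqrt{\alpha_1/\alpha_2})-\operatorname{erf}(\frac{x}{2\sqrt{\alpha_2t}})}{\operatorname{erf}(\lambda_1\sqrt{\alpha_1/\alpha_2})-\operatorname{erf}(\lambda_2\sqrt{\alpha_1/\alpha_2})},$$ $$\theta_1=D+(C-D)\frac{\operatorname{erfc}(\frac{x}{2\sqrt{\alpha_1t}})}{\operatorname{erfc}(\lambda_1)},\qquad s_i=2\lambda_i\sqrt{\alpha_1t}.$$ **Theorem.** The coefficients $\lambda_1,\lambda_2$ (for $q_0>q_2$) and $\mu_1,\mu_2$ (for $A>B$) are well defined, and: (a) Let $q_0>q_2$ and $A=B+\frac{q_0\sqrt{\pi\alpha_3}}{k_3}\operatorname{erf}\big(\lambda_2\sqrt{\alpha_1/\alpha_3}\big)$. Then $A>B$, the unique solution of (P3) with datum $q_0$ is $(\theta_1,\theta_2,\theta_3,s_1,s_2)$, the unique solution of (P2) with datum $A$ is $(u_1,u_2,u_3,r_1,r_2)$, and these two solutions coincide. (b) Let $A>B$ and suppose that $$\frac{k_3(A-B)}{\sqrt{\alpha_3}\operatorname{erf}\big(\mu_2\sqrt{\alpha_1/\alpha_3}\big)}>\frac{k_2(B-C)}{\sqrt{\alpha_2}\operatorname{erf}\big(z_0\sqrt{\alpha_1/\alpha_2}\big)}.$$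 Put $q_0=\frac{k_3}{\sqrt{\pi\alpha_3}}\frac{A-B}{\operatorname{erf}(\mu_2\sqrt{\alpha_1/\alpha_3})}$. Then $q_0>q_2$, the unique solution of (P2) with datum $A$ is $(u_1,u_2,u_3,r_1,r_2)$, the unique solution of (P3) with datum $q_0$ is $(\theta_1,\theta_2,\theta_3,s_1,s_2)$, and these two solutions coincide. -/

import Mathlib

open Set Filter Topology

noncomputable section

namespace Stefan

/-- The error function `erf x = (2 / √π) ∫₀ˣ exp (-s²) ds`. -/
def erf (x : ℝ) : ℝ := 2 / √Real.pi * ∫ s in (0 : ℝ)..x, Real.exp (-s ^ 2)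

/-- The complementary error function. -/
def erfc (x : ℝ) : ℝ := 1 - erf x

/-- The inverse of the (injective) error function; meaningful on the range `(-1, 1)` of `erf`. -/
def erfInv : ℝ → ℝ := Function.invFun erf

/-- The physical data common to all three-phase problems: thermal conductivities `kᵢ`, specific
heats `cᵢ`, mass density `ρ`, latent heats per unit mass `ℓᵢ`, the phase change temperatures `B`
and `C`, and the initial temperature `D`. -/
structure Data where
  (k₁ k₂ k₃ c₁ c₂ c₃ ρ ℓ₁ ℓ₂ B C D : ℝ)

namespace Data

variable (p : Data)

/-- The thermal diffusivities `αᵢ = kᵢ / (ρ cᵢ)`. -/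
def α₁ : ℝ := p.k₁ / (p.ρ * p.c₁)
def α₂ : ℝ := p.k₂ / (p.ρ * p.c₂)
def α₃ : ℝ := p.k₃ / (p.ρ * p.c₃)

/-- The latent heats per unit volume `δᵢ = ρ ℓᵢ`. -/
def δ₁ : ℝ := p.ρ * p.ℓ₁
def δ₂ : ℝ := p.ρ * p.ℓ₂

/-- The standing assumptions on the data. -/
structure Admissible : Prop where
  k₁_pos : 0 < p.k₁
  k₂_pos : 0 < p.k₂
  k₃_pos : 0 < p.k₃
  c₁_pos : 0 < p.c₁
  c₂_pos : 0 < p.c₂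
  c₃_pos : 0 < p.c₃
  ρ_pos : 0 < p.ρ
  ℓ₁_pos : 0 < p.ℓ₁
  ℓ₂_pos : 0 < p.ℓ₂
  C_lt_B : p.C < p.B
  D_lt_C : p.D < p.C
  α₃_lt_α₂ : p.α₃ < p.α₂

/-- The Stefan numbers. -/
def Ste₁ : ℝ := p.c₁ * (p.C - p.D) / p.ℓ₁
def Ste₂ : ℝ := p.c₂ * (p.B - p.C) / p.ℓ₂

def φ (z : ℝ) : ℝ := z + p.Ste₁ / √Real.pi * (Real.exp (-z ^ 2) / erfc z)

def H (z : ℝ) : ℝ :=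
  erf (z * √(p.α₁ / p.α₂)) -
    p.Ste₂ / √Real.pi * (p.ℓ₂ / p.ℓ₁) * √(p.k₂ * p.c₁ / (p.k₁ * p.c₂)) *
      (Real.exp (-z ^ 2 * (p.α₁ / p.α₂)) / p.φ z)

/-- `z₀ = H⁻¹(0)`, where `H` is regarded as a function on `[0, ∞)`. -/
def z₀ : ℝ := Function.invFunOn p.H (Ici 0) 0

def Q (z : ℝ) : ℝ := p.ℓ₁ / p.ℓ₂ * p.φ z * Real.exp (z ^ 2 * (p.α₁ / p.α₂))

def V (A z : ℝ) : ℝ :=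
  (A - p.B) / p.ℓ₂ * √(p.c₁ * p.c₃ * p.k₃ / (Real.pi * p.k₁)) *
      (Real.exp (-z ^ 2 * (p.α₁ / p.α₃ - p.α₁ / p.α₂)) / erf (z * √(p.α₁ / p.α₃))) -
    z * Real.exp (z ^ 2 * (p.α₁ / p.α₂))

def P (q₀ z : ℝ) : ℝ :=
  Real.exp (z ^ 2 * (p.α₁ / p.α₂)) *
    (-z + q₀ / p.ℓ₂ * √(p.c₁ / (p.ρ * p.k₁)) * Real.exp (-z ^ 2 * (p.α₁ / p.α₃)))

/-- The critical flux coefficient. -/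
def q₂ : ℝ :=
  p.k₂ * (p.B - p.C) / (√(p.α₂ * Real.pi) * erf (p.z₀ * √(p.α₁ / p.α₂)))

/-- `z₂ = √(α₂/α₁) erf⁻¹(H(z₁))`: how the coefficient of the inner free boundary is obtained from
the coefficient of the outer one. -/
def inner (z₁ : ℝ) : ℝ := √(p.α₂ / p.α₁) * erfInv (p.H z₁)

/-- `μ₁ > z₀` is the unique solution of `Q(z) = V(√(α₂/α₁) erf⁻¹(H(z)))`, `z > z₀`, and
`μ₂ = √(α₂/α₁) erf⁻¹(H(μ₁))`. -/
def IsDirichletCoeff (A μ₁ μ₂ : ℝ) : Prop :=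
  p.z₀ < μ₁ ∧ p.Q μ₁ = p.V A (p.inner μ₁) ∧
    (∀ z, p.z₀ < z → p.Q z = p.V A (p.inner z) → z = μ₁) ∧
    μ₂ = p.inner μ₁

/-- `l₁ > z₀` is the unique solution of `Q(z) = P(√(α₂/α₁) erf⁻¹(H(z)))`, `z > z₀`, and
`l₂ = √(α₂/α₁) erf⁻¹(H(l₁))`. -/
def IsNeumannCoeff (q₀ l₁ l₂ : ℝ) : Prop :=
  p.z₀ < l₁ ∧ p.Q l₁ = p.P q₀ (p.inner l₁) ∧
    (∀ z, p.z₀ < z → p.Q z = p.P q₀ (p.inner z) → z = l₁) ∧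
    l₂ = p.inner l₁

end Data

/-- Candidate solutions: the temperatures `Φᵢ x t` of the three phases and the two free boundaries
`x = yᵢ t`. Only the values of `yᵢ` at `t ≥ 0`, and those of `Φᵢ` on the closed `i`-th phase at
times `t > 0`, are meaningful. -/
structure Candidate where
  (Φ₁ Φ₂ Φ₃ : ℝ → ℝ → ℝ)
  (y₁ y₂ : ℝ → ℝ)

namespace Candidate

/-- The closed phases. -/
def phase₃ (S : Candidate) : Set (ℝ × ℝ) := {z | 0 < z.2 ∧ 0 ≤ z.1 ∧ z.1 ≤ S.y₂ z.2}
def phase₂ (S : Candidate) : Set (ℝ × ℝ) := {z | 0 < z.2 ∧ S.y₂ z.2 ≤ z.1 ∧ z.1 ≤ S.y₁ z.2}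
def phase₁ (S : Candidate) : Set (ℝ × ℝ) := {z | 0 < z.2 ∧ S.y₁ z.2 ≤ z.1}

/-- Two candidates coincide: same free boundaries, same temperature in each phase. -/
def Coincide (S S' : Candidate) : Prop :=
  (∀ t, 0 ≤ t → S.y₁ t = S'.y₁ t ∧ S.y₂ t = S'.y₂ t) ∧
  (∀ z ∈ S.phase₃, S.Φ₃ z.1 z.2 = S'.Φ₃ z.1 z.2) ∧
  (∀ z ∈ S.phase₂, S.Φ₂ z.1 z.2 = S'.Φ₂ z.1 z.2) ∧
  (∀ z ∈ S.phase₁, S.Φ₁ z.1 z.2 = S'.Φ₁ z.1 z.2)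

end Candidate

/-- `Φ` satisfies `∂Φ/∂t = α ∂²Φ/∂x²` in the classical sense at all points of the open set `R`. -/
def HeatOn (α : ℝ) (Φ : ℝ → ℝ → ℝ) (R : Set (ℝ × ℝ)) : Prop :=
  ∃ Φx Φxx : ℝ → ℝ → ℝ, ∀ x t, (x, t) ∈ R →
    HasDerivAt (fun ξ => Φ ξ t) (Φx x t) x ∧
    HasDerivAt (fun ξ => Φx ξ t) (Φxx x t) x ∧
    HasDerivAt (fun τ => Φ x τ) (α * Φxx x t) t

/-- The conditions common to all three-phase Stefan problems. Spatial derivatives at the free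
boundaries are one-sided, taken from inside the phase in question, and `Φ₁(x,0) = Φ₁(+∞,t) = D`
is a statement about limits. -/
structure IsStefanSolution (p : Data) (S : Candidate) : Prop where
  y₁_cont : ContinuousOn S.y₁ (Ici 0)
  y₂_cont : ContinuousOn S.y₂ (Ici 0)
  y₁_zero : S.y₁ 0 = 0
  y₂_zero : S.y₂ 0 = 0
  ordered : ∀ t, 0 < t → 0 < S.y₂ t ∧ S.y₂ t < S.y₁ t
  cont₃ : ContinuousOn (Function.uncurry S.Φ₃) S.phase₃
  cont₂ : ContinuousOn (Function.uncurry S.Φ₂) S.phase₂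
  cont₁ : ContinuousOn (Function.uncurry S.Φ₁) S.phase₁
  heat₃ : HeatOn p.α₃ S.Φ₃ {z | 0 < z.2 ∧ 0 < z.1 ∧ z.1 < S.y₂ z.2}
  heat₂ : HeatOn p.α₂ S.Φ₂ {z | 0 < z.2 ∧ S.y₂ z.2 < z.1 ∧ z.1 < S.y₁ z.2}
  heat₁ : HeatOn p.α₁ S.Φ₁ {z | 0 < z.2 ∧ S.y₁ z.2 < z.1}
  temp_B : ∀ t, 0 < t → S.Φ₃ (S.y₂ t) t = p.B ∧ S.Φ₂ (S.y₂ t) t = p.B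
  temp_C : ∀ t, 0 < t → S.Φ₂ (S.y₁ t) t = p.C ∧ S.Φ₁ (S.y₁ t) t = p.C
  initial_D : ∀ x, 0 < x → Tendsto (fun t => S.Φ₁ x t) (𝓝[>] 0) (𝓝 p.D)
  infinity_D : ∀ t, 0 < t → Tendsto (fun x => S.Φ₁ x t) atTop (𝓝 p.D)
  stefan₂ : ∀ t, 0 < t → ∃ a b v : ℝ,
    HasDerivWithinAt (fun x => S.Φ₂ x t) a (Icc (S.y₂ t) (S.y₁ t)) (S.y₂ t) ∧
    HasDerivWithinAt (fun x => S.Φ₃ x t) b (Icc 0 (S.y₂ t)) (S.y₂ t) ∧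
    HasDerivAt S.y₂ v t ∧ p.k₂ * a - p.k₃ * b = p.δ₂ * v
  stefan₁ : ∀ t, 0 < t → ∃ a b v : ℝ,
    HasDerivWithinAt (fun x => S.Φ₁ x t) a (Ici (S.y₁ t)) (S.y₁ t) ∧
    HasDerivWithinAt (fun x => S.Φ₂ x t) b (Icc (S.y₂ t) (S.y₁ t)) (S.y₁ t) ∧
    HasDerivAt S.y₁ v t ∧ p.k₁ * a - p.k₂ * b = p.δ₁ * v

/-- Similarity type: each temperature is a function of the similarity variable
`x / (2 √(αᵢ t))` alone, and the free boundaries are `yᵢ(t) = 2 ξᵢ √(α₁ t)`. The profiles `fᵢ`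
are arbitrary functions. -/
def IsSimilarityType (p : Data) (S : Candidate) : Prop :=
  (∃ ξ₁ ξ₂ : ℝ, ∀ t, 0 < t → S.y₁ t = 2 * ξ₁ * √(p.α₁ * t) ∧ S.y₂ t = 2 * ξ₂ * √(p.α₁ * t)) ∧
  (∃ f₃ : ℝ → ℝ, ∀ z ∈ S.phase₃, S.Φ₃ z.1 z.2 = f₃ (z.1 / (2 * √(p.α₃ * z.2)))) ∧
  (∃ f₂ : ℝ → ℝ, ∀ z ∈ S.phase₂, S.Φ₂ z.1 z.2 = f₂ (z.1 / (2 * √(p.α₂ * z.2)))) ∧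
  (∃ f₁ : ℝ → ℝ, ∀ z ∈ S.phase₁, S.Φ₁ z.1 z.2 = f₁ (z.1 / (2 * √(p.α₁ * z.2))))

/-- Similarity-type solutions of (P2): the three-phase problem with the Dirichlet condition
`Φ₃(0,t) = A`. -/
def IsSolutionP2 (p : Data) (A : ℝ) (S : Candidate) : Prop :=
  IsStefanSolution p S ∧ IsSimilarityType p S ∧ ∀ t, 0 < t → S.Φ₃ 0 t = A

/-- Similarity-type solutions of (P3): the three-phase problem with the Neumann condition
`k₃ ∂Φ₃/∂x(0,t) = -q₀/√t`. -/
def IsSolutionP3 (p : Data) (q₀ : ℝ) (S : Candidate) : Prop :=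
  IsStefanSolution p S ∧ IsSimilarityType p S ∧ ∀ t, 0 < t → ∃ a : ℝ,
    HasDerivWithinAt (fun x => S.Φ₃ x t) a (Icc 0 (S.y₂ t)) 0 ∧ p.k₃ * a = -q₀ / √t

/-- `S` is the unique object with property `Sol`, up to coincidence of candidates. -/
def IsTheSolution (Sol : Candidate → Prop) (S : Candidate) : Prop :=
  Sol S ∧ ∀ S', Sol S' → S.Coincide S'

/-- The functions `u₁, u₂, u₃, r₁, r₂` with coefficients `μ₁, μ₂`. -/
def dirichletSolution (p : Data) (A μ₁ μ₂ : ℝ) : Candidate where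
  Φ₃ x t :=
    A * ((erf (μ₂ * √(p.α₁ / p.α₃)) - erf (x / (2 * √(p.α₃ * t)))) / erf (μ₂ * √(p.α₁ / p.α₃))) +
      p.B * (erf (x / (2 * √(p.α₃ * t))) / erf (μ₂ * √(p.α₁ / p.α₃)))
  Φ₂ x t :=
    ((p.C - p.B) * erf (x / (2 * √(p.α₂ * t))) - p.C * erf (μ₂ * √(p.α₁ / p.α₂)) +
        p.B * erf (μ₁ * √(p.α₁ / p.α₂))) /
      (erf (μ₁ * √(p.α₁ / p.α₂)) - erf (μ₂ * √(p.α₁ / p.α₂)))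
  Φ₁ x t := p.D + (p.C - p.D) * (erfc (x / (2 * √(p.α₁ * t))) / erfc μ₁)
  y₂ t := 2 * μ₂ * √(p.α₁ * t)
  y₁ t := 2 * μ₁ * √(p.α₁ * t)

/-- The functions `θ₁, θ₂, θ₃, s₁, s₂` with coefficients `l₁, l₂`. -/
def neumannSolution (p : Data) (q₀ l₁ l₂ : ℝ) : Candidate where
  Φ₃ x t :=
    p.B + q₀ * √(Real.pi * p.α₃) / p.k₃ *
      (erf (l₂ * √(p.α₁ / p.α₃)) - erf (x / (2 * √(p.α₃ * t))))
  Φ₂ x t :=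
    p.C + (p.B - p.C) *
      ((erf (l₁ * √(p.α₁ / p.α₂)) - erf (x / (2 * √(p.α₂ * t)))) /
        (erf (l₁ * √(p.α₁ / p.α₂)) - erf (l₂ * √(p.α₁ / p.α₂))))
  Φ₁ x t := p.D + (p.C - p.D) * (erfc (x / (2 * √(p.α₁ * t))) / erfc l₁)
  y₂ t := 2 * l₂ * √(p.α₁ * t)
  y₁ t := 2 * l₁ * √(p.α₁ * t)

end Stefan

end

/-! ### The error function and a tail bound -/

namespace Stefan

/-! A similarity solution of the heat equation has a profile with `f'' = -2 x f'`, so in each phase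
the temperature is `a + c * erf` of the similarity variable. The values `B`, `C` at the free
boundaries and `D` at infinity fix everything except the boundary coefficients `ξ₁`, `ξ₂` and one
slope `g` in the third phase, where only one boundary value is prescribed. This is the family
`profile p ξ₁ ξ₂ g`, and every similarity solution belongs to it (`exists_profile`).

In the Stefan conditions all terms scale as `1/√t`, which leaves two algebraic equations. The outer
one is equivalent to `erf (ξ₂ * √(α₁/α₂)) = H ξ₁`, that is `ξ₂ = inner ξ₁` with `ξ₁ > z₀`; given it,
the inner one reads `Q ξ₁ = innerBalance g ξ₂` (`isBalanced_iff`).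

The two problems differ only in how the condition at `x = 0` fixes `g`: a temperature `A` gives `g =
(A - B) / erf (ξ₂ * √(α₁/α₃))`, a flux `q₀` gives `g = q₀ * √(π α₃) / k₃`. Inserting these turns
`innerBalance` into `V A` and `P q₀` respectively (`V_eq`, `P_eq`). In both cases the left side of
the equation increases in `ξ₁` and the right side decreases, so there is at most one root. A root
exists because `V A` blows up at `0`, while for `P q₀` the value at `0` exceeds `Q z₀` when `q₀ >
q₂` (`exists_unique_Q_eq`).

The relations between `A` and `q₀` in (a) and (b) say precisely that both data induce the same slope
`g` at the known coefficients. These coefficients then solve the other problem's equation too, and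
uniqueness of the root makes the two solutions the same profile. -/

theorem hasDerivAt_erf (x : ℝ) : HasDerivAt erf (2 / √Real.pi * Real.exp (-x ^ 2)) x := by
  have hc : Continuous fun s : ℝ => Real.exp (-s ^ 2) := by fun_prop
  exact (intervalIntegral.integral_hasDerivAt_right (hc.intervalIntegrable _ _)
    (hc.stronglyMeasurableAtFilter _ _) hc.continuousAt).const_mul _

theorem continuous_erf : Continuous erf :=
  continuous_iff_continuousAt.2 fun x => (hasDerivAt_erf x).continuousAt

theorem sqrt_pi_pos : 0 < √Real.pi := Real.sqrt_pos.2 Real.pi_pos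

theorem strictMono_erf : StrictMono erf :=
  strictMono_of_hasDerivAt_pos hasDerivAt_erf fun x => by have := sqrt_pi_pos; positivity

@[simp] theorem erf_zero : erf 0 = 0 := by simp [erf]

theorem tendsto_erf_atTop : Tendsto erf atTop (𝓝 1) := by
  have h := MeasureTheory.intervalIntegral_tendsto_integral_Ioi (μ := MeasureTheory.volume)
    (f := fun s : ℝ => Real.exp (-s ^ 2)) 0
    (by simpa using (integrable_exp_neg_mul_sq one_pos).integrableOn) tendsto_id
  have hg := integral_gaussian_Ioi 1
  simp only [neg_mul, one_mul, div_one] at hg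
  rw [hg] at h
  have := h.const_mul (2 / √Real.pi)
  have e : 2 / √Real.pi * (√Real.pi / 2) = 1 := by
    have := sqrt_pi_pos.ne'
    field_simp
  rw [e] at this
  exact this

theorem erf_lt_one (x : ℝ) : erf x < 1 :=
  (strictMono_erf (lt_add_one x)).trans_le
    (strictMono_erf.monotone.ge_of_tendsto tendsto_erf_atTop _)

theorem erf_pos {x : ℝ} (hx : 0 < x) : 0 < erf x := by
  simpa using strictMono_erf hx

theorem erfc_pos (x : ℝ) : 0 < erfc x := sub_pos.2 (erf_lt_one x)

theorem hasDerivAt_erfc (x : ℝ) : HasDerivAt erfc (-(2 / √Real.pi * Real.exp (-x ^ 2))) x :=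
  (hasDerivAt_erf x).const_sub 1

theorem continuous_erfc : Continuous erfc := continuous_const.sub continuous_erf

theorem tendsto_erfc_atTop : Tendsto erfc atTop (𝓝 0) := by
  have := tendsto_erf_atTop.const_sub 1
  rw [sub_self] at this
  exact this

theorem erfInv_erf (x : ℝ) : erfInv (erf x) = x :=
  Function.leftInverse_invFun strictMono_erf.injective x

theorem erf_erfInv {y : ℝ} (hy : y ∈ range erf) : erf (erfInv y) = y :=
  Function.invFun_eq hy

theorem mem_range_erf {y : ℝ} (h0 : 0 ≤ y) (h1 : y < 1) : y ∈ range erf := by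
  obtain ⟨b, hb⟩ := (tendsto_erf_atTop.eventually (lt_mem_nhds h1)).exists
  exact mem_range_of_exists_le_of_exists_ge continuous_erf ⟨0, by simpa using h0⟩ ⟨b, hb.le⟩

/-- A strictly monotone map with order-connected range is an embedding, so continuity may be tested
after composing with `erf`, where the composite is the identity. -/
theorem continuousOn_erfInv : ContinuousOn erfInv (range erf) := by
  have hemb := strictMono_erf.isEmbedding_of_ordConnected
    (isPreconnected_range continuous_erf).ordConnected
  rw [hemb.isInducing.continuousOn_iff]
  exact continuousOn_id.congr fun y hy => erf_erfInv hy

theorem hasDerivAt_exp_neg_sq (x : ℝ) :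
    HasDerivAt (fun z : ℝ => Real.exp (-z ^ 2)) (-2 * x * Real.exp (-x ^ 2)) x := by
  have := ((hasDerivAt_pow 2 x).neg).exp
  refine this.congr_deriv ?_
  simp
  ring

/-- The difference `erfc z - exp (-z²) / (√π z)` has the positive derivative `exp (-z²) / (√π z²)`
and tends to `0` at infinity, so it is negative. -/
theorem mul_erfc_lt {x : ℝ} (hx : 0 < x) : √Real.pi * x * erfc x < Real.exp (-x ^ 2) := by
  have hpi := sqrt_pi_pos
  let h : ℝ → ℝ := fun z => erfc z - Real.exp (-z ^ 2) / (√Real.pi * z)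
  have hd : ∀ z, 0 < z → HasDerivAt h (Real.exp (-z ^ 2) / (√Real.pi * z ^ 2)) z := by
    intro z hz
    refine ((hasDerivAt_erfc z).sub ((hasDerivAt_exp_neg_sq z).div
      ((hasDerivAt_id z).const_mul (√Real.pi)) (mul_pos hpi hz).ne')).congr_deriv ?_
    simp only [id]
    field_simp
    ring
  have hmono : StrictMonoOn h (Ioi 0) := by
    refine strictMonoOn_of_deriv_pos (convex_Ioi 0)
      (fun z hz => (hd z hz).continuousAt.continuousWithinAt) fun z hz => ?_
    rw [interior_Ioi] at hz
    have hz' : 0 < z := hz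
    rw [(hd z hz).deriv]
    positivity
  have hlim : Tendsto h atTop (𝓝 0) := by
    have h2 : Tendsto (fun z : ℝ => Real.exp (-z ^ 2) / (√Real.pi * z)) atTop (𝓝 0) := by
      have h3 : Tendsto (fun z : ℝ => (√Real.pi * z)⁻¹) atTop (𝓝 0) :=
        (tendsto_id.const_mul_atTop hpi).inv_tendsto_atTop
      refine squeeze_zero' ?_ ?_ h3
      · filter_upwards [eventually_gt_atTop 0] with z hz
        positivity
      · filter_upwards [eventually_gt_atTop 0] with z hz
        rw [div_eq_mul_inv]
        have : Real.exp (-z ^ 2) ≤ 1 := Real.exp_le_one_iff.2 (by nlinarith)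
        exact mul_le_of_le_one_left (by positivity) this
    simpa using tendsto_erfc_atTop.sub h2
  -- The limit only yields `≤ 0`; passing through the intermediate point `x + 1` recovers
  -- strictness.
  have h1 : h x < h (x + 1) := hmono hx (by simp; linarith) (lt_add_one x)
  have h2 : h (x + 1) ≤ 0 := by
    refine ge_of_tendsto hlim ?_
    filter_upwards [eventually_ge_atTop (x + 1)] with w hw
    exact hmono.monotoneOn (by simp; linarith) (by simp; linarith) hw
  have h3 : erfc x < Real.exp (-x ^ 2) / (√Real.pi * x) := sub_neg.1 (h1.trans_le h2)
  rw [lt_div_iff₀ (by positivity)] at h3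
  linarith

/-- The numerator of the derivative is a positive multiple of `exp (-z²) - √π z erfc z`, which is
positive by `mul_erfc_lt`. The monotonicity of `φ`, hence of `H` and `Q`, rests on this. -/
theorem strictMonoOn_exp_neg_sq_div_erfc :
    StrictMonoOn (fun z : ℝ => Real.exp (-z ^ 2) / erfc z) (Ici 0) := by
  have hpi := sqrt_pi_pos
  have hd := fun z => (hasDerivAt_exp_neg_sq z).div (hasDerivAt_erfc z) (erfc_pos z).ne'
  refine strictMonoOn_of_deriv_pos (convex_Ici 0)
    (fun z hz => (hd z).continuousAt.continuousWithinAt) fun z hz => ?_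
  rw [interior_Ici] at hz
  have hz' : 0 < z := hz
  have hm := mul_erfc_lt hz'
  refine (hd z).deriv.symm ▸ div_pos ?_ (pow_pos (erfc_pos z) 2)
  have : -2 * z * Real.exp (-z ^ 2) * erfc z -
      Real.exp (-z ^ 2) * -(2 / √Real.pi * Real.exp (-z ^ 2)) =
      2 * Real.exp (-z ^ 2) / √Real.pi * (Real.exp (-z ^ 2) - √Real.pi * z * erfc z) := by
    field_simp
    ring
  rw [this]
  exact mul_pos (by positivity) (sub_pos.2 hm)

end Stefan

/-! ### The functions `φ`, `H`, `Q`, the map `inner`, and the Dirichlet coefficient -/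

namespace Stefan

namespace Data

variable {p : Data}

namespace Admissible

theorem α₁_pos (hp : p.Admissible) : 0 < p.α₁ := div_pos hp.k₁_pos (mul_pos hp.ρ_pos hp.c₁_pos)
theorem α₂_pos (hp : p.Admissible) : 0 < p.α₂ := div_pos hp.k₂_pos (mul_pos hp.ρ_pos hp.c₂_pos)
theorem α₃_pos (hp : p.Admissible) : 0 < p.α₃ := div_pos hp.k₃_pos (mul_pos hp.ρ_pos hp.c₃_pos)

theorem Ste₁_pos (hp : p.Admissible) : 0 < p.Ste₁ :=
  div_pos (mul_pos hp.c₁_pos (sub_pos.2 hp.D_lt_C)) hp.ℓ₁_pos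
theorem Ste₂_pos (hp : p.Admissible) : 0 < p.Ste₂ :=
  div_pos (mul_pos hp.c₂_pos (sub_pos.2 hp.C_lt_B)) hp.ℓ₂_pos

theorem sqrt_div₂_pos (hp : p.Admissible) : 0 < √(p.α₁ / p.α₂) :=
  Real.sqrt_pos.2 (div_pos hp.α₁_pos hp.α₂_pos)
theorem sqrt_div₃_pos (hp : p.Admissible) : 0 < √(p.α₁ / p.α₃) :=
  Real.sqrt_pos.2 (div_pos hp.α₁_pos hp.α₃_pos)

theorem div_lt_div (hp : p.Admissible) : p.α₁ / p.α₂ < p.α₁ / p.α₃ :=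
  div_lt_div_of_pos_left hp.α₁_pos hp.α₃_pos hp.α₃_lt_α₂

theorem H_coeff_pos (hp : p.Admissible) :
    0 < p.Ste₂ / √Real.pi * (p.ℓ₂ / p.ℓ₁) * √(p.k₂ * p.c₁ / (p.k₁ * p.c₂)) := by
  have := hp.Ste₂_pos
  have := hp.k₁_pos
  have := hp.k₂_pos
  have := hp.c₁_pos
  have := hp.c₂_pos
  have := hp.ℓ₁_pos
  have := hp.ℓ₂_pos
  have := sqrt_pi_pos
  positivity

theorem strictMonoOn_φ (hp : p.Admissible) : StrictMonoOn p.φ (Ici 0) := by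
  intro x hx y hy hxy
  exact add_lt_add hxy (mul_lt_mul_of_pos_left (strictMonoOn_exp_neg_sq_div_erfc hx hy hxy)
    (div_pos hp.Ste₁_pos sqrt_pi_pos))

theorem lt_φ (hp : p.Admissible) (z : ℝ) : z < p.φ z :=
  lt_add_of_pos_right _ (mul_pos (div_pos hp.Ste₁_pos sqrt_pi_pos)
    (div_pos (Real.exp_pos _) (erfc_pos z)))

theorem φ_pos (hp : p.Admissible) {z : ℝ} (hz : 0 ≤ z) : 0 < p.φ z := hz.trans_lt (hp.lt_φ z)

end Admissible

theorem continuous_φ : Continuous p.φ := by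
  have h : Continuous fun z : ℝ => Real.exp (-z ^ 2) / erfc z :=
    Continuous.div (by fun_prop) continuous_erfc fun z => (erfc_pos z).ne'
  exact continuous_id.add (continuous_const.mul h)

namespace Admissible

theorem continuousOn_H (hp : p.Admissible) : ContinuousOn p.H (Ici 0) := by
  refine ContinuousOn.sub (continuous_erf.comp (by fun_prop)).continuousOn ?_
  exact continuousOn_const.mul (ContinuousOn.div (by fun_prop) continuous_φ.continuousOn
    fun z hz => (hp.φ_pos hz).ne')

/-- The `erf` term increases; the subtracted quotient decreases because its numerator decreases
while `φ` grows. -/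
theorem strictMonoOn_H (hp : p.Admissible) : StrictMonoOn p.H (Ici 0) := by
  intro x hx y hy hxy
  have hx' : 0 ≤ x := hx
  have h1 : erf (x * √(p.α₁ / p.α₂)) < erf (y * √(p.α₁ / p.α₂)) :=
    strictMono_erf (mul_lt_mul_of_pos_right hxy hp.sqrt_div₂_pos)
  have ha := div_pos hp.α₁_pos hp.α₂_pos
  have h2 : Real.exp (-y ^ 2 * (p.α₁ / p.α₂)) / p.φ y
      ≤ Real.exp (-x ^ 2 * (p.α₁ / p.α₂)) / p.φ x := by
    refine div_le_div₀ (Real.exp_pos _).le (Real.exp_le_exp.2 ?_) (hp.φ_pos hx)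
      (hp.strictMonoOn_φ hx hy hxy).le
    refine mul_le_mul_of_nonneg_right ?_ ha.le
    nlinarith
  exact (sub_lt_sub_right h1 _).trans_le
    (sub_le_sub_left (mul_le_mul_of_nonneg_left h2 hp.H_coeff_pos.le) _)

theorem H_lt_erf (hp : p.Admissible) {z : ℝ} (hz : 0 ≤ z) : p.H z < erf (z * √(p.α₁ / p.α₂)) :=
  sub_lt_self _ (mul_pos hp.H_coeff_pos (div_pos (Real.exp_pos _) (hp.φ_pos hz)))

theorem tendsto_H_atTop (hp : p.Admissible) : Tendsto p.H atTop (𝓝 1) := by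
  have h1 : Tendsto (fun z : ℝ => erf (z * √(p.α₁ / p.α₂))) atTop (𝓝 1) :=
    tendsto_erf_atTop.comp (tendsto_id.atTop_mul_const hp.sqrt_div₂_pos)
  have h2 : Tendsto (fun z : ℝ => Real.exp (-z ^ 2 * (p.α₁ / p.α₂)) / p.φ z) atTop (𝓝 0) := by
    refine squeeze_zero' ?_ ?_ tendsto_inv_atTop_zero
    · filter_upwards [eventually_ge_atTop 0] with z hz
      exact div_nonneg (Real.exp_pos _).le (hp.φ_pos hz).le
    · filter_upwards [eventually_gt_atTop 0] with z hz
      rw [← one_div]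
      refine div_le_div₀ zero_le_one (Real.exp_le_one_iff.2 ?_) hz (hp.lt_φ z).le
      have := div_pos hp.α₁_pos hp.α₂_pos
      nlinarith [mul_nonneg (sq_nonneg z) this.le]
  have := h1.sub (h2.const_mul
    (p.Ste₂ / √Real.pi * (p.ℓ₂ / p.ℓ₁) * √(p.k₂ * p.c₁ / (p.k₁ * p.c₂))))
  rw [mul_zero, sub_zero] at this
  exact this

/-- `H` is negative at `0` and tends to `1`, so it has a root in `[0, ∞)` and `invFunOn` returns a
genuine one. -/
theorem z₀_spec (hp : p.Admissible) : 0 < p.z₀ ∧ p.H p.z₀ = 0 := by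
  have h0 : p.H 0 < 0 := by
    have := hp.H_lt_erf le_rfl
    rwa [zero_mul, erf_zero] at this
  obtain ⟨b, hb, hb'⟩ := ((tendsto_order.1 hp.tendsto_H_atTop).1 0 zero_lt_one |>.and
    (eventually_ge_atTop 0)).exists
  have hex : ∃ z ∈ Ici (0 : ℝ), p.H z = 0 := by
    obtain ⟨z, hz, hz'⟩ := intermediate_value_Icc hb'
      (hp.continuousOn_H.mono Icc_subset_Ici_self) ⟨h0.le, hb.le⟩
    exact ⟨z, hz.1, hz'⟩
  have hH : p.H p.z₀ = 0 := Function.invFunOn_eq hex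
  have hm : 0 ≤ p.z₀ := Function.invFunOn_mem hex
  refine ⟨hm.lt_of_ne fun h => ?_, hH⟩
  rw [← h] at hH
  exact h0.ne hH

theorem z₀_pos (hp : p.Admissible) : 0 < p.z₀ := hp.z₀_spec.1

theorem H_z₀ (hp : p.Admissible) : p.H p.z₀ = 0 := hp.z₀_spec.2

/-- From `z₀` on, `0 ≤ H < 1`, so `erfInv (H z)` is a true preimage and not the default value of
`invFun`. -/
theorem H_mem_range (hp : p.Admissible) {z : ℝ} (hz : p.z₀ ≤ z) : p.H z ∈ range erf := by
  have h0 : 0 ≤ z := hp.z₀_pos.le.trans hz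
  refine mem_range_erf ?_ ((hp.H_lt_erf h0).trans (erf_lt_one _))
  rw [← hp.H_z₀]
  exact hp.strictMonoOn_H.monotoneOn hp.z₀_pos.le h0 hz

theorem sqrt_div_mul_sqrt_div (hp : p.Admissible) : √(p.α₂ / p.α₁) * √(p.α₁ / p.α₂) = 1 := by
  have := hp.α₁_pos.ne'
  have := hp.α₂_pos.ne'
  rw [← Real.sqrt_mul (div_pos hp.α₂_pos hp.α₁_pos).le, Real.sqrt_eq_one]
  field_simp

theorem erf_inner (hp : p.Admissible) {z : ℝ} (hz : p.z₀ ≤ z) :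
    erf (p.inner z * √(p.α₁ / p.α₂)) = p.H z := by
  rw [inner, mul_right_comm, hp.sqrt_div_mul_sqrt_div, one_mul, erf_erfInv (hp.H_mem_range hz)]

/-- No lower bound on `z` is needed: the equation itself puts `H z` in the range of `erf`. -/
theorem eq_inner_of_erf_eq (hp : p.Admissible) {z w : ℝ}
    (h : erf (w * √(p.α₁ / p.α₂)) = p.H z) : w = p.inner z := by
  rw [inner, ← h, erfInv_erf, mul_left_comm, hp.sqrt_div_mul_sqrt_div, mul_one]

theorem inner_z₀ (hp : p.Admissible) : p.inner p.z₀ = 0 :=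
  (hp.eq_inner_of_erf_eq (by rw [zero_mul, erf_zero, hp.H_z₀])).symm

theorem strictMonoOn_inner (hp : p.Admissible) : StrictMonoOn p.inner (Ici p.z₀) := by
  intro x hx y hy hxy
  have hx' : p.z₀ ≤ x := hx
  have h : p.H x < p.H y :=
    hp.strictMonoOn_H (hp.z₀_pos.le.trans hx) (hp.z₀_pos.le.trans hy) hxy
  rw [← hp.erf_inner hx, ← hp.erf_inner hy] at h
  exact lt_of_mul_lt_mul_right (strictMono_erf.lt_iff_lt.1 h) hp.sqrt_div₂_pos.le

theorem inner_pos (hp : p.Admissible) {z : ℝ} (hz : p.z₀ < z) : 0 < p.inner z := by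
  rw [← hp.inner_z₀]
  exact hp.strictMonoOn_inner self_mem_Ici hz.le hz

/-- This is the ordering of the two free boundaries; it comes from the positive term subtracted in
`H`. -/
theorem inner_lt_self (hp : p.Admissible) {z : ℝ} (hz : p.z₀ ≤ z) : p.inner z < z := by
  have h := hp.H_lt_erf (hp.z₀_pos.le.trans hz)
  rw [← hp.erf_inner hz] at h
  exact lt_of_mul_lt_mul_right (strictMono_erf.lt_iff_lt.1 h) hp.sqrt_div₂_pos.le

theorem continuousOn_inner (hp : p.Admissible) : ContinuousOn p.inner (Ici p.z₀) :=
  continuousOn_const.mul (continuousOn_erfInv.comp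
    (hp.continuousOn_H.mono (Ici_subset_Ici.2 hp.z₀_pos.le)) fun _ hz => hp.H_mem_range hz)

theorem strictMonoOn_Q (hp : p.Admissible) : StrictMonoOn p.Q (Ici 0) := by
  intro x hx y hy hxy
  have hx' : 0 ≤ x := hx
  have hl := div_pos hp.ℓ₁_pos hp.ℓ₂_pos
  refine mul_lt_mul (mul_lt_mul_of_pos_left (hp.strictMonoOn_φ hx hy hxy) hl)
    (Real.exp_le_exp.2 ?_) (Real.exp_pos _) (mul_pos hl (hp.φ_pos hy)).le
  exact mul_le_mul_of_nonneg_right (by nlinarith) (div_pos hp.α₁_pos hp.α₂_pos).le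

end Admissible

theorem continuous_Q : Continuous p.Q :=
  (continuous_const.mul continuous_φ).mul (by fun_prop)

namespace Admissible

theorem tendsto_Q_atTop (hp : p.Admissible) : Tendsto p.Q atTop atTop := by
  have hl := div_pos hp.ℓ₁_pos hp.ℓ₂_pos
  refine tendsto_atTop_mono' atTop ?_ (tendsto_id.const_mul_atTop hl)
  filter_upwards [eventually_ge_atTop 0] with z hz
  have h1 : 1 ≤ Real.exp (z ^ 2 * (p.α₁ / p.α₂)) :=
    Real.one_le_exp (mul_nonneg (sq_nonneg z) (div_pos hp.α₁_pos hp.α₂_pos).le)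
  calc p.ℓ₁ / p.ℓ₂ * z ≤ p.ℓ₁ / p.ℓ₂ * p.φ z := mul_le_mul_of_nonneg_left (hp.lt_φ z).le hl.le
    _ ≤ p.Q z := le_mul_of_one_le_right (mul_pos hl (hp.φ_pos hz)).le h1

/-- `Q(z) = G(inner z)` has exactly one solution `z > z₀` if `G` is strictly decreasing and exceeds
`Q(z₀)` near `0`. -/
theorem exists_unique_Q_eq (hp : p.Admissible) {G : ℝ → ℝ} (hG : StrictAntiOn G (Ioi 0))
    (hGc : ContinuousOn G (Ioi 0)) {c : ℝ} (hc : p.Q p.z₀ < c) (h0 : ∀ᶠ w in 𝓝[>] 0, c < G w) :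
    ∃ z, p.z₀ < z ∧ p.Q z = G (p.inner z) ∧
      ∀ z', p.z₀ < z' → p.Q z' = G (p.inner z') → z' = z := by
  let F : ℝ → ℝ := fun z => p.Q z - G (p.inner z)
  have hF : StrictMonoOn F (Ioi p.z₀) := by
    intro x hx y hy hxy
    have hx' : p.z₀ < x := hx
    have hy' : p.z₀ < y := hy
    exact sub_lt_sub (hp.strictMonoOn_Q (hp.z₀_pos.trans hx).le (hp.z₀_pos.trans hy).le hxy)
      (hG (hp.inner_pos hx) (hp.inner_pos hy) (hp.strictMonoOn_inner hx'.le hy'.le hxy))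
  have hFc : ContinuousOn F (Ioi p.z₀) :=
    continuous_Q.continuousOn.sub (hGc.comp (hp.continuousOn_inner.mono Ioi_subset_Ici_self)
      fun z hz => hp.inner_pos hz)
  have hin : Tendsto p.inner (𝓝[>] p.z₀) (𝓝[>] 0) := by
    refine tendsto_nhdsWithin_iff.2 ⟨?_, ?_⟩
    · have := (hp.continuousOn_inner p.z₀ self_mem_Ici).tendsto
      rw [hp.inner_z₀] at this
      exact this.mono_left (nhdsWithin_mono _ Ioi_subset_Ici_self)
    · filter_upwards [self_mem_nhdsWithin] with z hz using hp.inner_pos hz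
  -- Just to the right of `z₀` the value `c` separates `Q` from `G ∘ inner`, so `F x < 0`.
  obtain ⟨x, ⟨hx1, hx2⟩, hx⟩ := ((hin.eventually h0).and
    (nhdsWithin_le_nhds (continuous_Q.continuousAt.eventually (gt_mem_nhds hc)))
    |>.and self_mem_nhdsWithin).exists
  have hx' : p.z₀ < x := hx
  -- Since `G ∘ inner` decreases, it suffices for `F y ≥ 0` that `Q y` has reached the earlier value
  -- `G (inner x)`.
  obtain ⟨y, hy, hxy⟩ := ((hp.tendsto_Q_atTop.eventually_ge_atTop (G (p.inner x))).and
    (eventually_gt_atTop x)).exists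
  have hGxy := hG (hp.inner_pos hx) (hp.inner_pos (hx'.trans hxy))
    (hp.strictMonoOn_inner hx'.le (hx'.trans hxy).le hxy)
  obtain ⟨z, hz, hFz⟩ := intermediate_value_Icc (f := F) hxy.le
    (hFc.mono fun z hz => hx'.trans_le hz.1) (show (0 : ℝ) ∈ Icc (F x) (F y) from
      ⟨sub_nonpos.2 (hx2.trans hx1).le, sub_nonneg.2 (hGxy.le.trans hy)⟩)
  refine ⟨z, hx'.trans_le hz.1, sub_eq_zero.1 hFz, fun z' hz' h => ?_⟩
  exact hF.injOn hz' (hx'.trans_le hz.1) ((sub_eq_zero.2 h).trans hFz.symm)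

theorem strictMonoOn_mul_exp (hp : p.Admissible) :
    StrictMonoOn (fun z : ℝ => z * Real.exp (z ^ 2 * (p.α₁ / p.α₂))) (Ici 0) := by
  intro x hx y hy hxy
  have hx' : 0 ≤ x := hx
  refine mul_lt_mul hxy (Real.exp_le_exp.2 ?_) (Real.exp_pos _) hy
  exact mul_le_mul_of_nonneg_right (by nlinarith) (div_pos hp.α₁_pos hp.α₂_pos).le

/-- The assumption `α₃ < α₂` enters here: it makes the coefficient of `-z²` in the exponent
positive. -/
theorem antitoneOn_exp (hp : p.Admissible) :
    AntitoneOn (fun z : ℝ => Real.exp (-z ^ 2 * (p.α₁ / p.α₃ - p.α₁ / p.α₂))) (Ici 0) := by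
  intro x hx y hy hxy
  have hx' : 0 ≤ x := hx
  exact Real.exp_le_exp.2 (mul_le_mul_of_nonneg_right (by nlinarith) (sub_pos.2 hp.div_lt_div).le)

theorem V_coeff_pos (hp : p.Admissible) {A : ℝ} (hA : p.B < A) :
    0 < (A - p.B) / p.ℓ₂ * √(p.c₁ * p.c₃ * p.k₃ / (Real.pi * p.k₁)) := by
  have := hp.k₁_pos
  have := hp.k₃_pos
  have := hp.c₁_pos
  have := hp.c₃_pos
  have := hp.ℓ₂_pos
  have := Real.pi_pos
  have := sub_pos.2 hA
  positivity

/-- `V A` is strictly decreasing on `(0, ∞)`, and the factor `1 / erf` makes it tend to infinity at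
`0`, so every `A > B` is allowed. -/
theorem exists_isDirichletCoeff (hp : p.Admissible) {A : ℝ} (hA : p.B < A) :
    ∃ μ, p.IsDirichletCoeff A μ (p.inner μ) := by
  have hK := hp.V_coeff_pos hA
  have hb := hp.sqrt_div₃_pos
  have hpos : ∀ z : ℝ, 0 < z → 0 < erf (z * √(p.α₁ / p.α₃)) :=
    fun z hz => erf_pos (mul_pos hz hb)
  have hanti : StrictAntiOn (p.V A) (Ioi 0) := by
    intro x hx y hy hxy
    have hx' : 0 < x := hx
    have hy' : 0 < y := hy
    refine (sub_lt_sub_left (hp.strictMonoOn_mul_exp hx'.le hy'.le hxy) _).trans_le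
      (sub_le_sub_right (mul_le_mul_of_nonneg_left ?_ hK.le) _)
    exact div_le_div₀ (Real.exp_pos _).le (hp.antitoneOn_exp hx'.le hy'.le hxy.le) (hpos x hx)
      (strictMono_erf.monotone (mul_le_mul_of_nonneg_right hxy.le hb.le))
  have hcont : ContinuousOn (p.V A) (Ioi 0) := by
    refine ContinuousOn.sub (continuousOn_const.mul (ContinuousOn.div (by fun_prop)
      (continuous_erf.comp (by fun_prop)).continuousOn fun z hz => (hpos z hz).ne')) (by fun_prop)
  have hlim : Tendsto (p.V A) (𝓝[>] 0) atTop := by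
    have h1 : Tendsto (fun z : ℝ => Real.exp (-z ^ 2 * (p.α₁ / p.α₃ - p.α₁ / p.α₂)))
        (𝓝[>] 0) (𝓝 1) := by
      have : Continuous fun z : ℝ => Real.exp (-z ^ 2 * (p.α₁ / p.α₃ - p.α₁ / p.α₂)) := by
        fun_prop
      simpa using (this.tendsto 0).mono_left (nhdsWithin_le_nhds (s := Ioi 0))
    have h2 : Tendsto (fun z : ℝ => erf (z * √(p.α₁ / p.α₃))) (𝓝[>] 0) (𝓝[>] 0) := by
      refine tendsto_nhdsWithin_iff.2 ⟨?_, ?_⟩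
      · have : Continuous fun z : ℝ => erf (z * √(p.α₁ / p.α₃)) :=
          continuous_erf.comp (by fun_prop)
        simpa using (this.tendsto 0).mono_left (nhdsWithin_le_nhds (s := Ioi 0))
      · filter_upwards [self_mem_nhdsWithin] with z hz using hpos z hz
    have h3 : Tendsto (fun z : ℝ => z * Real.exp (z ^ 2 * (p.α₁ / p.α₂))) (𝓝[>] 0) (𝓝 0) := by
      have : Continuous fun z : ℝ => z * Real.exp (z ^ 2 * (p.α₁ / p.α₂)) := by fun_prop
      simpa using (this.tendsto 0).mono_left (nhdsWithin_le_nhds (s := Ioi 0))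
    have h4 := ((h1.pos_mul_atTop one_pos h2.inv_tendsto_nhdsGT_zero).const_mul_atTop hK).atTop_add
      h3.neg
    refine h4.congr fun z => ?_
    simp only [V, div_eq_mul_inv, sub_eq_add_neg, Pi.inv_apply]
  -- As `V A` is unbounded near `0`, any separating value above `Q z₀` would do.
  obtain ⟨μ, h1, h2, h3⟩ := hp.exists_unique_Q_eq hanti hcont (lt_add_one _)
    (hlim.eventually_gt_atTop (p.Q p.z₀ + 1))
  exact ⟨μ, h1, h2, h3, rfl⟩

end Admissible

end Data

end Stefan

/-! ### The Stefan conditions as equations for the coefficients, and the Neumann coefficient -/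

noncomputable section

namespace Stefan

namespace Data

/-- The right-hand side of the equation for the coefficient of the outer boundary, in terms of the
slope `g` of the temperature of the third phase with respect to `erf`. -/
def innerBalance (p : Data) (g w : ℝ) : ℝ :=
  p.k₃ * g / (√Real.pi * √p.α₃ * (p.δ₂ * √p.α₁)) *
      Real.exp (-w ^ 2 * (p.α₁ / p.α₃ - p.α₁ / p.α₂)) - w * Real.exp (w ^ 2 * (p.α₁ / p.α₂))

/-- The coefficients `ξ₁, ξ₂` of the free boundaries are ordered and satisfy the two Stefan
conditions, `g` being the slope of the temperature of the third phase with respect to `erf`. -/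
structure IsBalanced (p : Data) (ξ₁ ξ₂ g : ℝ) : Prop where
  pos : 0 < ξ₂
  lt : ξ₂ < ξ₁
  outer : p.k₂ * (p.B - p.C) /
        (√Real.pi * √p.α₂ * (erf (ξ₁ * √(p.α₁ / p.α₂)) - erf (ξ₂ * √(p.α₁ / p.α₂)))) *
        Real.exp (-ξ₁ ^ 2 * (p.α₁ / p.α₂)) -
      p.k₁ * (p.C - p.D) / (√Real.pi * √p.α₁ * erfc ξ₁) * Real.exp (-ξ₁ ^ 2) =
    p.δ₁ * (√p.α₁ * ξ₁)
  inner : p.k₃ * g / (√Real.pi * √p.α₃) * Real.exp (-ξ₂ ^ 2 * (p.α₁ / p.α₃)) -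
      p.k₂ * (p.B - p.C) /
        (√Real.pi * √p.α₂ * (erf (ξ₁ * √(p.α₁ / p.α₂)) - erf (ξ₂ * √(p.α₁ / p.α₂)))) *
        Real.exp (-ξ₂ ^ 2 * (p.α₁ / p.α₂)) =
    p.δ₂ * (√p.α₁ * ξ₂)

variable {p : Data}

namespace Admissible

theorem δ₁_pos (hp : p.Admissible) : 0 < p.δ₁ := mul_pos hp.ρ_pos hp.ℓ₁_pos
theorem δ₂_pos (hp : p.Admissible) : 0 < p.δ₂ := mul_pos hp.ρ_pos hp.ℓ₂_pos
theorem sqrt_α₁_pos (hp : p.Admissible) : 0 < √p.α₁ := Real.sqrt_pos.2 hp.α₁_pos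
theorem sqrt_α₂_pos (hp : p.Admissible) : 0 < √p.α₂ := Real.sqrt_pos.2 hp.α₂_pos
theorem sqrt_α₃_pos (hp : p.Admissible) : 0 < √p.α₃ := Real.sqrt_pos.2 hp.α₃_pos

/-- Eliminating the conductivities in favour of `√αᵢ` leaves the coefficient identities below
rational in the square roots, within reach of `field_simp`. -/
theorem k₁_eq (hp : p.Admissible) : p.k₁ = √p.α₁ ^ 2 * p.ρ * p.c₁ := by
  have := hp.ρ_pos
  have := hp.c₁_pos
  rw [Real.sq_sqrt hp.α₁_pos.le, α₁]
  field_simp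
theorem k₂_eq (hp : p.Admissible) : p.k₂ = √p.α₂ ^ 2 * p.ρ * p.c₂ := by
  have := hp.ρ_pos
  have := hp.c₂_pos
  rw [Real.sq_sqrt hp.α₂_pos.le, α₂]
  field_simp
theorem k₃_eq (hp : p.Admissible) : p.k₃ = √p.α₃ ^ 2 * p.ρ * p.c₃ := by
  have := hp.ρ_pos
  have := hp.c₃_pos
  rw [Real.sq_sqrt hp.α₃_pos.le, α₃]
  field_simp

theorem H_coeff_eq (hp : p.Admissible) :
    p.Ste₂ / √Real.pi * (p.ℓ₂ / p.ℓ₁) * √(p.k₂ * p.c₁ / (p.k₁ * p.c₂)) =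
      p.k₂ * (p.B - p.C) / (√Real.pi * √p.α₂ * (p.δ₁ * √p.α₁)) := by
  have := hp.c₁_pos
  have := hp.c₂_pos
  have := hp.ρ_pos
  have := hp.ℓ₁_pos
  have := hp.ℓ₂_pos
  have h1 := hp.sqrt_α₁_pos
  have h2 := hp.sqrt_α₂_pos
  have := sqrt_pi_pos
  have h : √(p.k₂ * p.c₁ / (p.k₁ * p.c₂)) = √p.α₂ / √p.α₁ := by
    rw [Real.sqrt_eq_iff_mul_self_eq_of_pos (by positivity), hp.k₁_eq, hp.k₂_eq]
    field_simp
  rw [h, hp.k₂_eq, Ste₂, δ₁]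
  field_simp

theorem V_coeff_eq (hp : p.Admissible) :
    √(p.c₁ * p.c₃ * p.k₃ / (Real.pi * p.k₁)) =
      p.c₃ * √p.α₃ / (√Real.pi * √p.α₁) := by
  have := hp.c₁_pos
  have := hp.c₃_pos
  have := hp.ρ_pos
  have := hp.sqrt_α₁_pos
  have := hp.sqrt_α₃_pos
  have := sqrt_pi_pos
  have hpi : Real.pi = √Real.pi ^ 2 := (Real.sq_sqrt Real.pi_pos.le).symm
  rw [Real.sqrt_eq_iff_mul_self_eq_of_pos (by positivity), hp.k₁_eq, hp.k₃_eq]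
  conv_rhs => rw [hpi]
  field_simp

theorem P_coeff_eq (hp : p.Admissible) : √(p.c₁ / (p.ρ * p.k₁)) = 1 / (p.ρ * √p.α₁) := by
  have := hp.c₁_pos
  have := hp.ρ_pos
  have := hp.sqrt_α₁_pos
  rw [Real.sqrt_eq_iff_mul_self_eq_of_pos (by positivity), hp.k₁_eq]
  field_simp

/-- With `P_eq`, this exhibits both right-hand sides as one function of the slope `g`, which is what
links the two problems. -/
theorem V_eq (hp : p.Admissible) (A w : ℝ) :
    p.V A w = p.innerBalance ((A - p.B) / erf (w * √(p.α₁ / p.α₃))) w := by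
  have := hp.ρ_pos
  have := hp.ℓ₂_pos
  have := hp.sqrt_α₁_pos
  have := hp.sqrt_α₃_pos
  have := sqrt_pi_pos
  rw [V, innerBalance, hp.V_coeff_eq, hp.k₃_eq, δ₂]
  congr 1
  field_simp

theorem P_eq (hp : p.Admissible) (q w : ℝ) :
    p.P q w = p.innerBalance (q * √(Real.pi * p.α₃) / p.k₃) w := by
  have := hp.ρ_pos
  have := hp.ℓ₂_pos
  have := hp.k₃_pos
  have := hp.sqrt_α₁_pos
  have := hp.sqrt_α₃_pos
  have := sqrt_pi_pos
  have h : Real.exp (-w ^ 2 * (p.α₁ / p.α₃ - p.α₁ / p.α₂)) =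
      Real.exp (-w ^ 2 * (p.α₁ / p.α₃)) * Real.exp (w ^ 2 * (p.α₁ / p.α₂)) := by
    rw [← Real.exp_add]
    ring_nf
  rw [P, innerBalance, hp.P_coeff_eq, δ₂, h, Real.sqrt_mul Real.pi_pos.le]
  field_simp
  ring

theorem innerBalance_coeff_pos (hp : p.Admissible) {g : ℝ} (hg : 0 < g) :
    0 < p.k₃ * g / (√Real.pi * √p.α₃ * (p.δ₂ * √p.α₁)) := by
  have := hp.k₃_pos
  have := hp.δ₂_pos
  have := hp.sqrt_α₁_pos
  have := hp.sqrt_α₃_pos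
  have := sqrt_pi_pos
  positivity

/-- The left side is `P q₂ 0`, so `q₂` is the flux at which the coefficient equation holds at `z₀`
itself, where the inner boundary degenerates to `0`. The equation `H z₀ = 0` replaces the `erf` in
`q₂` by the quotient with `φ z₀`. -/
theorem q₂_mul_eq (hp : p.Admissible) :
    p.q₂ / p.ℓ₂ * √(p.c₁ / (p.ρ * p.k₁)) = p.Q p.z₀ := by
  have hH : erf (p.z₀ * √(p.α₁ / p.α₂)) - _ * _ = 0 := hp.H_z₀
  have hφ := hp.φ_pos hp.z₀_pos.le
  have := hp.k₂_pos
  have := hp.ρ_pos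
  have := hp.ℓ₁_pos
  have := hp.ℓ₂_pos
  have := hp.sqrt_α₁_pos
  have := hp.sqrt_α₂_pos
  have := sqrt_pi_pos
  have := sub_pos.2 hp.C_lt_B
  have he : Real.exp (-p.z₀ ^ 2 * (p.α₁ / p.α₂)) =
      (Real.exp (p.z₀ ^ 2 * (p.α₁ / p.α₂)))⁻¹ := by
    rw [← Real.exp_neg, neg_mul]
  rw [q₂, sub_eq_zero.1 hH, hp.H_coeff_eq, hp.P_coeff_eq, he, Real.sqrt_mul hp.α₂_pos.le, Q, δ₁]
  have := Real.exp_pos (p.z₀ ^ 2 * (p.α₁ / p.α₂))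
  field_simp

theorem q₂_pos (hp : p.Admissible) : 0 < p.q₂ :=
  div_pos (mul_pos hp.k₂_pos (sub_pos.2 hp.C_lt_B)) (mul_pos
    (Real.sqrt_pos.2 (mul_pos hp.α₂_pos Real.pi_pos))
    (erf_pos (mul_pos hp.z₀_pos hp.sqrt_div₂_pos)))

/-- Unlike `V A`, the function `P q` is finite at `0`; the hypothesis `q₂ < q` is what gives `Q z₀ <
P q 0`. Monotonicity is read off from the `innerBalance` form. -/
theorem exists_isNeumannCoeff (hp : p.Admissible) {q : ℝ} (hq : p.q₂ < q) :
    ∃ l, p.IsNeumannCoeff q l (p.inner l) := by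
  have hk := hp.k₁_pos
  have hc := hp.c₁_pos
  have hρ := hp.ρ_pos
  have hQ : p.Q p.z₀ < p.P q 0 := by
    have h0 : p.P q 0 = q / p.ℓ₂ * √(p.c₁ / (p.ρ * p.k₁)) := by simp [P]
    rw [h0, ← hp.q₂_mul_eq]
    exact mul_lt_mul_of_pos_right (div_lt_div_of_pos_right hq hp.ℓ₂_pos)
      (Real.sqrt_pos.2 (by positivity))
  have hg : 0 < q * √(Real.pi * p.α₃) / p.k₃ :=
    div_pos (mul_pos (hp.q₂_pos.trans hq)
      (Real.sqrt_pos.2 (mul_pos Real.pi_pos hp.α₃_pos))) hp.k₃_pos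
  have hanti : StrictAntiOn (p.P q) (Ioi 0) := by
    intro x hx y hy hxy
    rw [hp.P_eq, hp.P_eq]
    exact (sub_lt_sub_left (hp.strictMonoOn_mul_exp (Ioi_subset_Ici_self hx)
      (Ioi_subset_Ici_self hy) hxy) _).trans_le (sub_le_sub_right (mul_le_mul_of_nonneg_left
      (hp.antitoneOn_exp (Ioi_subset_Ici_self hx) (Ioi_subset_Ici_self hy) hxy.le)
      (hp.innerBalance_coeff_pos hg).le) _)
  have hcont : Continuous (p.P q) := by
    unfold P
    fun_prop
  obtain ⟨c, hc1, hc2⟩ := exists_between hQ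
  obtain ⟨l, h1, h2, h3⟩ := hp.exists_unique_Q_eq hanti hcont.continuousOn hc1
    (nhdsWithin_le_nhds (hcont.continuousAt.eventually (lt_mem_nhds hc2)))
  exact ⟨l, h1, h2, h3, rfl⟩

/-- Let `Y` be the flux coefficient of the middle phase. The outer condition collects into `φ ξ₁`
and becomes `Y = δ₂ √α₁ Q ξ₁`; solving this for the difference of `erf` values inside `Y` gives `erf
(ξ₂ √(α₁/α₂)) = H ξ₁`. Substituting `Y` in the inner condition and multiplying by `exp (ξ₂² α₁/α₂)`
gives the equation with `innerBalance`. -/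
theorem isBalanced_iff (hp : p.Admissible) (ξ₁ ξ₂ g : ℝ) :
    p.IsBalanced ξ₁ ξ₂ g ↔
      p.z₀ < ξ₁ ∧ ξ₂ = p.inner ξ₁ ∧ p.Q ξ₁ = p.innerBalance g ξ₂ := by
  have key : 0 < ξ₂ → ξ₂ < ξ₁ → (p.IsBalanced ξ₁ ξ₂ g ↔
      erf (ξ₂ * √(p.α₁ / p.α₂)) = p.H ξ₁ ∧ p.Q ξ₁ = p.innerBalance g ξ₂) := by
    intro h2 h21
    have hφ := hp.φ_pos (h2.trans h21).le
    have hΔ : 0 < erf (ξ₁ * √(p.α₁ / p.α₂)) - erf (ξ₂ * √(p.α₁ / p.α₂)) :=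
      sub_pos.2 (strictMono_erf (mul_lt_mul_of_pos_right h21 hp.sqrt_div₂_pos))
    have hρ := hp.ρ_pos
    have hl1 := hp.ℓ₁_pos
    have hl2 := hp.ℓ₂_pos
    have hs1 := hp.sqrt_α₁_pos
    have hs2 := hp.sqrt_α₂_pos
    have hs3 := hp.sqrt_α₃_pos
    have hpi := sqrt_pi_pos
    have hδ1 := hp.δ₁_pos
    have hδ2 := hp.δ₂_pos
    have herfc := erfc_pos ξ₁
    set Δ := erf (ξ₁ * √(p.α₁ / p.α₂)) - erf (ξ₂ * √(p.α₁ / p.α₂)) with hΔdef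
    set Y := p.k₂ * (p.B - p.C) / (√Real.pi * √p.α₂ * Δ) with hY
    have e1 : Real.exp (-ξ₁ ^ 2 * (p.α₁ / p.α₂)) = (Real.exp (ξ₁ ^ 2 * (p.α₁ / p.α₂)))⁻¹ := by
      rw [← Real.exp_neg, neg_mul]
    have e2 : Real.exp (-ξ₂ ^ 2 * (p.α₁ / p.α₂)) = (Real.exp (ξ₂ ^ 2 * (p.α₁ / p.α₂)))⁻¹ := by
      rw [← Real.exp_neg, neg_mul]
    have e3 : Real.exp (-ξ₂ ^ 2 * (p.α₁ / p.α₃ - p.α₁ / p.α₂)) =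
        Real.exp (-ξ₂ ^ 2 * (p.α₁ / p.α₃)) * Real.exp (ξ₂ ^ 2 * (p.α₁ / p.α₂)) := by
      rw [← Real.exp_add]
      ring_nf
    have hE1 := Real.exp_pos (ξ₁ ^ 2 * (p.α₁ / p.α₂))
    have hE2 := Real.exp_pos (ξ₂ ^ 2 * (p.α₁ / p.α₂))
    have hφeq : p.δ₁ * √p.α₁ * p.φ ξ₁ = p.δ₁ * (√p.α₁ * ξ₁) +
        p.k₁ * (p.C - p.D) / (√Real.pi * √p.α₁ * erfc ξ₁) * Real.exp (-ξ₁ ^ 2) := by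
      rw [φ, Ste₁, hp.k₁_eq, δ₁]
      field_simp
    have houter : (Y * Real.exp (-ξ₁ ^ 2 * (p.α₁ / p.α₂)) -
        p.k₁ * (p.C - p.D) / (√Real.pi * √p.α₁ * erfc ξ₁) * Real.exp (-ξ₁ ^ 2) =
        p.δ₁ * (√p.α₁ * ξ₁)) ↔ Y = p.δ₂ * √p.α₁ * p.Q ξ₁ := by
      rw [sub_eq_iff_eq_add, ← hφeq, e1, Q, δ₁, δ₂]
      field_simp
    have hH : erf (ξ₂ * √(p.α₁ / p.α₂)) = p.H ξ₁ ↔ Y = p.δ₂ * √p.α₁ * p.Q ξ₁ := by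
      rw [H, hp.H_coeff_eq, e1, Q, δ₁, δ₂, eq_sub_iff_add_eq, ← eq_sub_iff_add_eq', ← hΔdef, hY]
      field_simp
    have hinner : Y = p.δ₂ * √p.α₁ * p.Q ξ₁ →
        ((p.k₃ * g / (√Real.pi * √p.α₃) * Real.exp (-ξ₂ ^ 2 * (p.α₁ / p.α₃)) -
        Y * Real.exp (-ξ₂ ^ 2 * (p.α₁ / p.α₂)) = p.δ₂ * (√p.α₁ * ξ₂)) ↔
        p.Q ξ₁ = p.innerBalance g ξ₂) := by
      intro h
      rw [h, innerBalance, e2, e3]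
      field_simp
      constructor <;> intro h' <;> linarith
    rw [hH]
    constructor
    · intro h
      have hY' := houter.1 h.outer
      exact ⟨hY', (hinner hY').1 h.inner⟩
    · rintro ⟨hY', h⟩
      exact ⟨h2, h21, houter.2 hY', (hinner hY').2 h⟩
  constructor
  · intro h
    obtain ⟨h1, h2⟩ := (key h.pos h.lt).1 h
    refine ⟨?_, hp.eq_inner_of_erf_eq h1, h2⟩
    -- Positivity of the inner boundary forces `H ξ₁ > 0 = H z₀`, hence `ξ₁ > z₀`.
    have hH : p.H p.z₀ < p.H ξ₁ := by
      rw [hp.H_z₀, ← h1]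
      exact erf_pos (mul_pos h.pos hp.sqrt_div₂_pos)
    exact (hp.strictMonoOn_H.lt_iff_lt hp.z₀_pos.le (h.pos.trans h.lt).le).1 hH
  · rintro ⟨h1, rfl, h3⟩
    exact (key (hp.inner_pos h1) (hp.inner_lt_self h1.le)).2 ⟨hp.erf_inner h1.le, h3⟩

end Admissible

end Data

end Stefan

end

/-! ### Similarity solutions of the heat equation -/

noncomputable section

namespace Stefan

theorem HeatOn.mono {α : ℝ} {Φ : ℝ → ℝ → ℝ} {R R' : Set (ℝ × ℝ)} (h : HeatOn α Φ R)
    (hR : R' ⊆ R) : HeatOn α Φ R' :=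
  let ⟨Φx, Φxx, h⟩ := h
  ⟨Φx, Φxx, fun x t hxt => h x t (hR hxt)⟩

theorem hasDerivAt_erf_similarity {α t : ℝ} (hα : 0 < α) (a c x : ℝ) :
    HasDerivAt (fun x => a + c * erf (x / (2 * √(α * t))))
      (c * (Real.exp (-(x / (2 * √(α * t))) ^ 2) / (√Real.pi * √α * √t))) x := by
  refine ((((hasDerivAt_erf _).comp x ((hasDerivAt_id x).div_const _)).const_mul c).const_add
    a).congr_deriv ?_
  simp only [id]
  rw [Real.sqrt_mul hα.le]
  field_simp

theorem heatOn_erf_similarity {α : ℝ} (hα : 0 < α) (a c : ℝ) :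
    HeatOn α (fun x t => a + c * erf (x / (2 * √(α * t)))) {z | 0 < z.2} := by
  refine ⟨_, fun x t => c * (-2 * (x / (2 * √(α * t))) * Real.exp (-(x / (2 * √(α * t))) ^ 2) *
    (1 / (2 * √(α * t))) / (√Real.pi * √α * √t)), fun x t ht =>
    ⟨hasDerivAt_erf_similarity hα a c x, ?_, ?_⟩⟩
  · exact (((hasDerivAt_exp_neg_sq _).comp x ((hasDerivAt_id x).div_const _)).div_const
      _).const_mul c
  · have ht' : 0 < t := ht
    have hpos : 0 < α * t := mul_pos hα ht
    have hs : 0 < √(α * t) := Real.sqrt_pos.2 hpos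
    have h1 : HasDerivAt (fun τ => √(α * τ)) (α * 1 / (2 * √(α * t))) t :=
      ((hasDerivAt_id t).const_mul α).sqrt hpos.ne'
    have h2 := (hasDerivAt_const t x).div (h1.const_mul 2) (mul_pos two_pos hs).ne'
    refine ((((hasDerivAt_erf _).comp t h2).const_mul c).const_add a).congr_deriv ?_
    have h1 := Real.sqrt_pos.2 hα
    have h2 := Real.sqrt_pos.2 ht'
    have := sqrt_pi_pos
    simp only [Pi.div_apply]
    rw [Real.sqrt_mul hα.le]
    field_simp
    rw [Real.sq_sqrt hα.le]
    ring

theorem continuousOn_erf_similarity {α : ℝ} (hα : 0 < α) (a c : ℝ) :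
    ContinuousOn (Function.uncurry fun x t => a + c * erf (x / (2 * √(α * t))))
      {z | 0 < z.2} := by
  refine continuousOn_const.add (continuousOn_const.mul (continuous_erf.comp_continuousOn
    (ContinuousOn.div (by fun_prop) (by fun_prop) fun z hz => ?_)))
  exact (mul_pos two_pos (Real.sqrt_pos.2 (mul_pos hα hz))).ne'

/-- The profile of a solution of the heat equation that depends on the similarity variable alone
solves `f'' = -2 x f'`, and so is an affine function of `erf`. -/
theorem exists_profile_eq_erf {α : ℝ} (hα : 0 < α) {Φ : ℝ → ℝ → ℝ} {f : ℝ → ℝ} {I : Set ℝ}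
    (hI : IsOpen I) (hI' : IsPreconnected I)
    (hΦ : ∀ x t, 0 < t → x / (2 * √(α * t)) ∈ I → Φ x t = f (x / (2 * √(α * t))))
    (hheat : HeatOn α Φ {z | 0 < z.2 ∧ z.1 / (2 * √(α * z.2)) ∈ I}) :
    ∃ a c, ∀ x ∈ I, f x = a + c * erf x := by
  obtain ⟨Φx, Φxx, h⟩ := hheat
  rcases I.eq_empty_or_nonempty with rfl | ⟨x₀, hx₀⟩
  · exact ⟨0, 0, by simp⟩
  have hα' : 0 < 4 * α := by positivity
  -- At this time `2 √(α T) = 1`, so the similarity variable is `x` and the profile is the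
  -- temperature itself.
  set T : ℝ := 1 / (4 * α) with hTdef
  have hT : 0 < T := by positivity
  have hsT : √(α * T) = 1 / 2 := by
    rw [Real.sqrt_eq_iff_mul_self_eq_of_pos (by norm_num), hTdef]
    field_simp
    norm_num
  have hvar : ∀ x : ℝ, x / (2 * √(α * T)) = x := by
    intro x
    rw [hsT]
    norm_num
  have hf1 : ∀ x ∈ I, HasDerivAt f (Φx x T) x := by
    intro x hx
    refine (h x T ⟨hT, by simpa only [hvar] using hx⟩).1.congr_of_eventuallyEq ?_
    filter_upwards [hI.mem_nhds hx] with y hy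
    have := hΦ y T hT (by rwa [hvar])
    rw [this, hvar]
  have hf2 : ∀ x ∈ I, HasDerivAt (fun x => Φx x T) (-2 * x * Φx x T) x := by
    intro x hx
    have hh := h x T ⟨hT, by simpa only [hvar] using hx⟩
    have hpos : 0 < α * T := mul_pos hα hT
    have h1 : HasDerivAt (fun τ => √(α * τ)) (α * 1 / (2 * √(α * T))) T :=
      ((hasDerivAt_id T).const_mul α).sqrt hpos.ne'
    have h2 := (hasDerivAt_const T x).div (h1.const_mul 2) (by rw [hsT]; norm_num)
    have hfx : HasDerivAt f (Φx x T) (x / (2 * √(α * T))) := by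
      rw [hvar]
      exact hf1 x hx
    have h3 := hfx.comp T h2
    have h4 : (f ∘ fun τ => x / (2 * √(α * τ))) =ᶠ[𝓝 T] fun τ => Φ x τ := by
      have hmem := h2.continuousAt.eventually
        (hI.mem_nhds (by simpa only [Pi.div_apply, hvar] using hx))
      filter_upwards [hmem, lt_mem_nhds hT] with τ h5 h6
      exact (hΦ x τ h6 h5).symm
    have h5 := (h3.congr_of_eventuallyEq h4.symm).unique hh.2.2
    rw [hsT] at h5
    -- At time `T` the similarity variable has time derivative `-2 α x`, so the chain rule and the
    -- heat equation give `-2 α x f' = α f''`.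
    have h6 : Φxx x T = -2 * x * Φx x T := by
      refine mul_left_cancel₀ hα.ne' ?_
      rw [← h5]
      ring
    exact h6 ▸ hh.2.1
  -- `exp (x²)` is an integrating factor for `f'' = -2 x f'`.
  have hd : ∀ x ∈ I, HasDerivAt (fun x => Φx x T * Real.exp (x ^ 2)) 0 x := by
    intro x hx
    refine ((hf2 x hx).mul (hasDerivAt_pow 2 x).exp).congr_deriv ?_
    simp
    ring
  have hconst : ∀ x ∈ I, Φx x T = Φx x₀ T * Real.exp (x₀ ^ 2) * Real.exp (-x ^ 2) := by
    intro x hx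
    have := hI.is_const_of_deriv_eq_zero hI'
      (fun y hy => (hd y hy).differentiableAt.differentiableWithinAt)
      (fun y hy => (hd y hy).deriv) hx hx₀
    rw [← this, mul_assoc, ← Real.exp_add]
    simp
  set c := √Real.pi / 2 * (Φx x₀ T * Real.exp (x₀ ^ 2)) with hc
  have hd' : ∀ x ∈ I, HasDerivAt (fun x => f x - c * erf x) 0 x := by
    intro x hx
    refine ((hf1 x hx).sub ((hasDerivAt_erf x).const_mul c)).congr_deriv ?_
    have := sqrt_pi_pos
    rw [hconst x hx, hc]
    field_simp
    ring
  refine ⟨f x₀ - c * erf x₀, c, fun x hx => ?_⟩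
  have := hI.is_const_of_deriv_eq_zero hI'
    (fun y hy => (hd' y hy).differentiableAt.differentiableWithinAt)
    (fun y hy => (hd' y hy).deriv) hx hx₀
  linarith

/-- The heat equation is known only inside a phase; continuity at the single time `1 / (4 α)`
carries the formula for the profile to the boundary points in `J`, and the similarity form carries
it to all times. -/
theorem exists_eq_erf_similarity {α : ℝ} (hα : 0 < α) {Φ : ℝ → ℝ → ℝ} {f : ℝ → ℝ} {I J : Set ℝ}
    (hI : IsOpen I) (hI' : IsPreconnected I) (hIJ : I ⊆ J) (hJI : J ⊆ closure I)
    (hΦ : ∀ x t, 0 < t → x / (2 * √(α * t)) ∈ J → Φ x t = f (x / (2 * √(α * t))))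
    (hcont : ContinuousOn (Function.uncurry Φ) {z | 0 < z.2 ∧ z.1 / (2 * √(α * z.2)) ∈ J})
    (hheat : HeatOn α Φ {z | 0 < z.2 ∧ z.1 / (2 * √(α * z.2)) ∈ I}) :
    ∃ a c, ∀ x t, 0 < t → x / (2 * √(α * t)) ∈ J →
      Φ x t = a + c * erf (x / (2 * √(α * t))) := by
  obtain ⟨a, c, h⟩ := exists_profile_eq_erf hα hI hI' (fun x t ht hx => hΦ x t ht (hIJ hx)) hheat
  have hα' : 0 < 4 * α := by positivity
  have hT : 0 < 1 / (4 * α) := by positivity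
  have hsT : √(α * (1 / (4 * α))) = 1 / 2 := by
    rw [Real.sqrt_eq_iff_mul_self_eq_of_pos (by norm_num)]
    field_simp
    norm_num
  have hvar : ∀ x : ℝ, x / (2 * √(α * (1 / (4 * α)))) = x := by
    intro x
    rw [hsT]
    norm_num
  have hf : ContinuousOn f J := by
    have h1 : ContinuousOn (fun x => Φ x (1 / (4 * α))) J :=
      hcont.comp (f := fun x : ℝ => (x, 1 / (4 * α))) (by fun_prop)
        fun x hx => ⟨hT, by simpa only [hvar] using hx⟩
    refine h1.congr fun x hx => ?_
    have := hΦ x _ hT (by rwa [hvar])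
    rw [hvar] at this
    exact this.symm
  have hJ : EqOn f (fun x => a + c * erf x) J :=
    EqOn.of_subset_closure h hf (continuous_const.add
      (continuous_const.mul continuous_erf)).continuousOn hIJ hJI
  exact ⟨a, c, fun x t ht hx => (hΦ x t ht hx).trans (hJ hx)⟩

theorem two_mul_mul_sqrt_eq {β α t : ℝ} (hβ : 0 ≤ β) (hα : 0 < α) (ξ : ℝ) :
    2 * ξ * √(β * t) = ξ * √(β / α) * (2 * √(α * t)) := by
  rw [Real.sqrt_mul hβ, Real.sqrt_mul hα.le, Real.sqrt_div hβ]
  have := Real.sqrt_pos.2 hα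
  field_simp

theorem hasDerivAt_boundary {β t : ℝ} (hβ : 0 < β) (ht : 0 < t) (ξ : ℝ) :
    HasDerivAt (fun t => 2 * ξ * √(β * t)) (√β * ξ / √t) t := by
  refine ((((hasDerivAt_id t).const_mul β).sqrt (mul_pos hβ ht).ne').const_mul
    (2 * ξ)).congr_deriv ?_
  have h1 := Real.sqrt_pos.2 hβ
  have h2 := Real.sqrt_pos.2 ht
  simp only [id]
  rw [Real.sqrt_mul hβ.le]
  field_simp
  rw [Real.sq_sqrt hβ.le]

end Stefan

end

/-! ### The three-phase profiles: existence and uniqueness for both problems -/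

noncomputable section

namespace Stefan

theorem similarity_boundary {β α t : ℝ} (hβ : 0 ≤ β) (hα : 0 < α) (ht : 0 < t) (ξ : ℝ) :
    2 * ξ * √(β * t) / (2 * √(α * t)) = ξ * √(β / α) := by
  rw [two_mul_mul_sqrt_eq hβ hα, mul_div_cancel_right₀]
  exact (mul_pos two_pos (Real.sqrt_pos.2 (mul_pos hα ht))).ne'

theorem similarity_le_iff {β α t : ℝ} (hβ : 0 ≤ β) (hα : 0 < α) (ht : 0 < t) (ξ x : ℝ) :
    x / (2 * √(α * t)) ≤ ξ * √(β / α) ↔ x ≤ 2 * ξ * √(β * t) := by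
  rw [two_mul_mul_sqrt_eq hβ hα, div_le_iff₀ (mul_pos two_pos (Real.sqrt_pos.2 (mul_pos hα ht)))]

theorem similarity_lt_iff {β α t : ℝ} (hβ : 0 ≤ β) (hα : 0 < α) (ht : 0 < t) (ξ x : ℝ) :
    x / (2 * √(α * t)) < ξ * √(β / α) ↔ x < 2 * ξ * √(β * t) := by
  rw [two_mul_mul_sqrt_eq hβ hα, div_lt_iff₀ (mul_pos two_pos (Real.sqrt_pos.2 (mul_pos hα ht)))]

theorem le_similarity_iff {β α t : ℝ} (hβ : 0 ≤ β) (hα : 0 < α) (ht : 0 < t) (ξ x : ℝ) :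
    ξ * √(β / α) ≤ x / (2 * √(α * t)) ↔ 2 * ξ * √(β * t) ≤ x := by
  rw [two_mul_mul_sqrt_eq hβ hα, le_div_iff₀ (mul_pos two_pos (Real.sqrt_pos.2 (mul_pos hα ht)))]

theorem lt_similarity_iff {β α t : ℝ} (hβ : 0 ≤ β) (hα : 0 < α) (ht : 0 < t) (ξ x : ℝ) :
    ξ * √(β / α) < x / (2 * √(α * t)) ↔ 2 * ξ * √(β * t) < x := by
  rw [two_mul_mul_sqrt_eq hβ hα, lt_div_iff₀ (mul_pos two_pos (Real.sqrt_pos.2 (mul_pos hα ht)))]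

theorem hasDerivAt_erf_similarity_boundary {β α t : ℝ} (hβ : 0 < β) (hα : 0 < α) (ht : 0 < t)
    (a c ξ : ℝ) :
    HasDerivAt (fun x => a + c * erf (x / (2 * √(α * t))))
      (c * (Real.exp (-ξ ^ 2 * (β / α)) / (√Real.pi * √α * √t))) (2 * ξ * √(β * t)) := by
  refine (hasDerivAt_erf_similarity hα a c _).congr_deriv ?_
  rw [similarity_boundary hβ.le hα ht, mul_pow, Real.sq_sqrt (div_pos hβ hα).le, neg_mul]

/-- The general solution of similarity type with temperatures `B`, `C` at the free boundaries and
`D` at infinity. -/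
def profile (p : Data) (ξ₁ ξ₂ g : ℝ) : Candidate where
  Φ₃ x t := p.B + g * (erf (ξ₂ * √(p.α₁ / p.α₃)) - erf (x / (2 * √(p.α₃ * t))))
  Φ₂ x t :=
    p.C + (p.B - p.C) *
      ((erf (ξ₁ * √(p.α₁ / p.α₂)) - erf (x / (2 * √(p.α₂ * t)))) /
        (erf (ξ₁ * √(p.α₁ / p.α₂)) - erf (ξ₂ * √(p.α₁ / p.α₂))))
  Φ₁ x t := p.D + (p.C - p.D) * (erfc (x / (2 * √(p.α₁ * t))) / erfc ξ₁)
  y₂ t := 2 * ξ₂ * √(p.α₁ * t)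
  y₁ t := 2 * ξ₁ * √(p.α₁ * t)

theorem profile_Φ₃ (p : Data) (ξ₁ ξ₂ g : ℝ) : (profile p ξ₁ ξ₂ g).Φ₃ = fun x t =>
    (p.B + g * erf (ξ₂ * √(p.α₁ / p.α₃))) + -g * erf (x / (2 * √(p.α₃ * t))) := by
  funext x t
  simp only [profile]
  ring

theorem profile_Φ₂ (p : Data) (ξ₁ ξ₂ g : ℝ) : (profile p ξ₁ ξ₂ g).Φ₂ = fun x t =>
    (p.C + (p.B - p.C) * (erf (ξ₁ * √(p.α₁ / p.α₂)) /
      (erf (ξ₁ * √(p.α₁ / p.α₂)) - erf (ξ₂ * √(p.α₁ / p.α₂))))) +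
    -((p.B - p.C) / (erf (ξ₁ * √(p.α₁ / p.α₂)) - erf (ξ₂ * √(p.α₁ / p.α₂)))) *
      erf (x / (2 * √(p.α₂ * t))) := by
  funext x t
  simp only [profile]
  ring

theorem profile_Φ₁ (p : Data) (ξ₁ ξ₂ g : ℝ) : (profile p ξ₁ ξ₂ g).Φ₁ = fun x t =>
    (p.D + (p.C - p.D) / erfc ξ₁) + -((p.C - p.D) / erfc ξ₁) * erf (x / (2 * √(p.α₁ * t))) := by
  funext x t
  simp only [profile]
  rw [show erfc (x / (2 * √(p.α₁ * t))) = 1 - erf (x / (2 * √(p.α₁ * t))) from rfl]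
  ring

section Profile

variable {p : Data}

theorem hasDerivAt_profile_Φ₃ (hp : p.Admissible) (ξ₁ ξ₂ g : ℝ) {t : ℝ} (ht : 0 < t) (ξ : ℝ) :
    HasDerivAt (fun x => (profile p ξ₁ ξ₂ g).Φ₃ x t)
      (-g * (Real.exp (-ξ ^ 2 * (p.α₁ / p.α₃)) / (√Real.pi * √p.α₃ * √t)))
      (2 * ξ * √(p.α₁ * t)) := by
  rw [profile_Φ₃]
  exact hasDerivAt_erf_similarity_boundary hp.α₁_pos hp.α₃_pos ht _ _ _

theorem hasDerivAt_profile_Φ₂ (hp : p.Admissible) (ξ₁ ξ₂ g : ℝ) {t : ℝ} (ht : 0 < t) (ξ : ℝ) :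
    HasDerivAt (fun x => (profile p ξ₁ ξ₂ g).Φ₂ x t)
      (-((p.B - p.C) / (erf (ξ₁ * √(p.α₁ / p.α₂)) - erf (ξ₂ * √(p.α₁ / p.α₂)))) *
        (Real.exp (-ξ ^ 2 * (p.α₁ / p.α₂)) / (√Real.pi * √p.α₂ * √t)))
      (2 * ξ * √(p.α₁ * t)) := by
  rw [profile_Φ₂]
  exact hasDerivAt_erf_similarity_boundary hp.α₁_pos hp.α₂_pos ht _ _ _

theorem hasDerivAt_profile_Φ₁ (hp : p.Admissible) (ξ₁ ξ₂ g : ℝ) {t : ℝ} (ht : 0 < t) (ξ : ℝ) :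
    HasDerivAt (fun x => (profile p ξ₁ ξ₂ g).Φ₁ x t)
      (-((p.C - p.D) / erfc ξ₁) * (Real.exp (-ξ ^ 2) / (√Real.pi * √p.α₁ * √t)))
      (2 * ξ * √(p.α₁ * t)) := by
  rw [profile_Φ₁]
  have := hasDerivAt_erf_similarity_boundary hp.α₁_pos hp.α₁_pos ht
    (p.D + (p.C - p.D) / erfc ξ₁) (-((p.C - p.D) / erfc ξ₁)) ξ
  rwa [div_self hp.α₁_pos.ne', mul_one] at this

/-- Every term of the Stefan condition carries the factor `1/√t`, so its validity at one instant is
equivalent to the time-free equation, and hence to its validity at every instant. The same holds for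
`inner_iff`. -/
theorem outer_iff (p : Data) (ξ₁ ξ₂ : ℝ) {t : ℝ} (ht : 0 < t) :
    p.k₁ * (-((p.C - p.D) / erfc ξ₁) * (Real.exp (-ξ₁ ^ 2) / (√Real.pi * √p.α₁ * √t))) -
      p.k₂ * (-((p.B - p.C) / (erf (ξ₁ * √(p.α₁ / p.α₂)) - erf (ξ₂ * √(p.α₁ / p.α₂)))) *
        (Real.exp (-ξ₁ ^ 2 * (p.α₁ / p.α₂)) / (√Real.pi * √p.α₂ * √t))) =
      p.δ₁ * (√p.α₁ * ξ₁ / √t) ↔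
    p.k₂ * (p.B - p.C) /
        (√Real.pi * √p.α₂ * (erf (ξ₁ * √(p.α₁ / p.α₂)) - erf (ξ₂ * √(p.α₁ / p.α₂)))) *
        Real.exp (-ξ₁ ^ 2 * (p.α₁ / p.α₂)) -
      p.k₁ * (p.C - p.D) / (√Real.pi * √p.α₁ * erfc ξ₁) * Real.exp (-ξ₁ ^ 2) =
    p.δ₁ * (√p.α₁ * ξ₁) := by
  generalize erf (ξ₁ * √(p.α₁ / p.α₂)) - erf (ξ₂ * √(p.α₁ / p.α₂)) = Δ
  rw [← div_left_inj' (Real.sqrt_pos.2 ht).ne' (c := √t) (b := p.δ₁ * (√p.α₁ * ξ₁))]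
  exact Eq.congr (by ring) (by ring)

theorem inner_iff (p : Data) (ξ₁ ξ₂ g : ℝ) {t : ℝ} (ht : 0 < t) :
    p.k₂ * (-((p.B - p.C) / (erf (ξ₁ * √(p.α₁ / p.α₂)) - erf (ξ₂ * √(p.α₁ / p.α₂)))) *
        (Real.exp (-ξ₂ ^ 2 * (p.α₁ / p.α₂)) / (√Real.pi * √p.α₂ * √t))) -
      p.k₃ * (-g * (Real.exp (-ξ₂ ^ 2 * (p.α₁ / p.α₃)) / (√Real.pi * √p.α₃ * √t))) =
      p.δ₂ * (√p.α₁ * ξ₂ / √t) ↔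
    p.k₃ * g / (√Real.pi * √p.α₃) * Real.exp (-ξ₂ ^ 2 * (p.α₁ / p.α₃)) -
      p.k₂ * (p.B - p.C) /
        (√Real.pi * √p.α₂ * (erf (ξ₁ * √(p.α₁ / p.α₂)) - erf (ξ₂ * √(p.α₁ / p.α₂)))) *
        Real.exp (-ξ₂ ^ 2 * (p.α₁ / p.α₂)) =
    p.δ₂ * (√p.α₁ * ξ₂) := by
  generalize erf (ξ₁ * √(p.α₁ / p.α₂)) - erf (ξ₂ * √(p.α₁ / p.α₂)) = Δ
  rw [← div_left_inj' (Real.sqrt_pos.2 ht).ne' (c := √t) (b := p.δ₂ * (√p.α₁ * ξ₂))]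
  exact Eq.congr (by ring) (by ring)

theorem erf_sub_pos (hp : p.Admissible) {ξ₁ ξ₂ : ℝ} (h : ξ₂ < ξ₁) :
    0 < erf (ξ₁ * √(p.α₁ / p.α₂)) - erf (ξ₂ * √(p.α₁ / p.α₂)) :=
  sub_pos.2 (strictMono_erf (mul_lt_mul_of_pos_right h hp.sqrt_div₂_pos))

theorem profile_at_zero (p : Data) (ξ₁ ξ₂ g t : ℝ) :
    (profile p ξ₁ ξ₂ g).Φ₃ 0 t = p.B + g * erf (ξ₂ * √(p.α₁ / p.α₃)) := by
  simp [profile]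

theorem hasDerivAt_profile_at_zero (hp : p.Admissible) (ξ₁ ξ₂ g : ℝ) {t : ℝ} (ht : 0 < t) :
    HasDerivAt (fun x => (profile p ξ₁ ξ₂ g).Φ₃ x t) (-g / (√Real.pi * √p.α₃ * √t)) 0 := by
  have := hasDerivAt_profile_Φ₃ hp ξ₁ ξ₂ g ht 0
  simp only [mul_zero, zero_mul] at this
  refine this.congr_deriv ?_
  simp [div_eq_mul_inv]

theorem isStefanSolution_profile (hp : p.Admissible) {ξ₁ ξ₂ g : ℝ} (h : p.IsBalanced ξ₁ ξ₂ g) :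
    IsStefanSolution p (profile p ξ₁ ξ₂ g) where
  y₁_cont := Continuous.continuousOn (by unfold profile; fun_prop)
  y₂_cont := Continuous.continuousOn (by unfold profile; fun_prop)
  y₁_zero := by simp [profile]
  y₂_zero := by simp [profile]
  ordered t ht := by
    have hs := Real.sqrt_pos.2 (mul_pos hp.α₁_pos ht)
    have := h.pos
    refine ⟨by simp only [profile]; positivity, ?_⟩
    exact mul_lt_mul_of_pos_right (mul_lt_mul_of_pos_left h.lt two_pos) hs
  cont₃ := by
    rw [profile_Φ₃]
    exact (continuousOn_erf_similarity hp.α₃_pos _ _).mono fun z hz => hz.1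
  cont₂ := by
    rw [profile_Φ₂]
    exact (continuousOn_erf_similarity hp.α₂_pos _ _).mono fun z hz => hz.1
  cont₁ := by
    rw [profile_Φ₁]
    exact (continuousOn_erf_similarity hp.α₁_pos _ _).mono fun z hz => hz.1
  heat₃ := by
    rw [profile_Φ₃]
    exact (heatOn_erf_similarity hp.α₃_pos _ _).mono fun z hz => hz.1
  heat₂ := by
    rw [profile_Φ₂]
    exact (heatOn_erf_similarity hp.α₂_pos _ _).mono fun z hz => hz.1
  heat₁ := by
    rw [profile_Φ₁]
    exact (heatOn_erf_similarity hp.α₁_pos _ _).mono fun z hz => hz.1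
  temp_B t ht := by
    simp only [profile, similarity_boundary hp.α₁_pos.le hp.α₃_pos ht,
      similarity_boundary hp.α₁_pos.le hp.α₂_pos ht, div_self (erf_sub_pos hp h.lt).ne']
    constructor <;> ring
  temp_C t ht := by
    simp only [profile, similarity_boundary hp.α₁_pos.le hp.α₂_pos ht,
      similarity_boundary hp.α₁_pos.le hp.α₁_pos ht, div_self hp.α₁_pos.ne', Real.sqrt_one,
      mul_one, div_self (erfc_pos ξ₁).ne']
    constructor <;> ring
  initial_D x hx := by
    have h1 : Tendsto (fun t => 2 * √(p.α₁ * t)) (𝓝[>] 0) (𝓝[>] 0) := by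
      refine tendsto_nhdsWithin_iff.2 ⟨?_, ?_⟩
      · have : Continuous fun t => 2 * √(p.α₁ * t) := by fun_prop
        simpa using (this.tendsto 0).mono_left (nhdsWithin_le_nhds (s := Ioi 0))
      · filter_upwards [self_mem_nhdsWithin] with t ht
        exact mul_pos two_pos (Real.sqrt_pos.2 (mul_pos hp.α₁_pos ht))
    have h2 := tendsto_erfc_atTop.comp (h1.inv_tendsto_nhdsGT_zero.const_mul_atTop hx)
    have := ((h2.div_const (erfc ξ₁)).const_mul (p.C - p.D)).const_add p.D
    simpa [profile, div_eq_mul_inv] using this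
  infinity_D t ht := by
    have h2 := tendsto_erfc_atTop.comp (tendsto_id.atTop_div_const
      (mul_pos two_pos (Real.sqrt_pos.2 (mul_pos hp.α₁_pos ht))))
    have := ((h2.div_const (erfc ξ₁)).const_mul (p.C - p.D)).const_add p.D
    simpa [profile] using this
  stefan₂ t ht := ⟨_, _, _, (hasDerivAt_profile_Φ₂ hp ξ₁ ξ₂ g ht ξ₂).hasDerivWithinAt,
    (hasDerivAt_profile_Φ₃ hp ξ₁ ξ₂ g ht ξ₂).hasDerivWithinAt,
    hasDerivAt_boundary hp.α₁_pos ht ξ₂, (inner_iff p ξ₁ ξ₂ g ht).2 h.inner⟩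
  stefan₁ t ht := ⟨_, _, _, (hasDerivAt_profile_Φ₁ hp ξ₁ ξ₂ g ht ξ₁).hasDerivWithinAt,
    (hasDerivAt_profile_Φ₂ hp ξ₁ ξ₂ g ht ξ₁).hasDerivWithinAt,
    hasDerivAt_boundary hp.α₁_pos ht ξ₁, (outer_iff p ξ₁ ξ₂ ht).2 h.outer⟩

theorem isSimilarityType_profile (p : Data) (ξ₁ ξ₂ g : ℝ) :
    IsSimilarityType p (profile p ξ₁ ξ₂ g) :=
  ⟨⟨ξ₁, ξ₂, fun _ _ => ⟨rfl, rfl⟩⟩,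
    ⟨fun η => p.B + g * (erf (ξ₂ * √(p.α₁ / p.α₃)) - erf η), fun _ _ => rfl⟩,
    ⟨fun η => p.C + (p.B - p.C) * ((erf (ξ₁ * √(p.α₁ / p.α₂)) - erf η) /
        (erf (ξ₁ * √(p.α₁ / p.α₂)) - erf (ξ₂ * √(p.α₁ / p.α₂)))), fun _ _ => rfl⟩,
    ⟨fun η => p.D + (p.C - p.D) * (erfc η / erfc ξ₁), fun _ _ => rfl⟩⟩

/-- In each phase the temperature is `a + c * erf`. Two conditions fix both constants in the middle
phase (`B` and `C`) and in the outer phase (`C` and the limit `D`); the third phase has only the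
value `B`, so one slope stays free. -/
theorem coincide_profile (hp : p.Admissible) {S : Candidate} (hS : IsStefanSolution p S)
    (hsim : IsSimilarityType p S) :
    ∃ ξ₁ ξ₂ g, 0 < ξ₂ ∧ ξ₂ < ξ₁ ∧ (profile p ξ₁ ξ₂ g).Coincide S := by
  obtain ⟨⟨ξ₁, ξ₂, hy⟩, ⟨f₃, h₃⟩, ⟨f₂, h₂⟩, ⟨f₁, h₁⟩⟩ := hsim
  have hα₁ := hp.α₁_pos
  have hα₂ := hp.α₂_pos
  have hα₃ := hp.α₃_pos
  have hs : ∀ t, 0 < t → 0 < √(p.α₁ * t) := fun t ht => Real.sqrt_pos.2 (mul_pos hα₁ ht)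
  obtain ⟨hξ₂, hξ⟩ : 0 < ξ₂ ∧ ξ₂ < ξ₁ := by
    obtain ⟨h1, h2⟩ := hS.ordered 1 one_pos
    rw [(hy 1 one_pos).1, (hy 1 one_pos).2] at h2
    rw [(hy 1 one_pos).2] at h1
    have := hs 1 one_pos
    have h2' := lt_of_mul_lt_mul_right h2 this.le
    have h1' := pos_of_mul_pos_left h1 this.le
    constructor <;> linarith
  have ha := hp.sqrt_div₂_pos
  have hb := hp.sqrt_div₃_pos
  -- the phases in terms of the similarity variables
  have m₃ : ∀ x t, 0 < t → (x / (2 * √(p.α₃ * t)) ∈ Icc 0 (ξ₂ * √(p.α₁ / p.α₃)) ↔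
      0 ≤ x ∧ x ≤ S.y₂ t) := fun x t ht => by
    rw [(hy t ht).2, mem_Icc, similarity_le_iff hα₁.le hα₃ ht,
      le_div_iff₀ (mul_pos two_pos (Real.sqrt_pos.2 (mul_pos hα₃ ht))), zero_mul]
  have m₃' : ∀ x t, 0 < t → (x / (2 * √(p.α₃ * t)) ∈ Ioo 0 (ξ₂ * √(p.α₁ / p.α₃)) ↔
      0 < x ∧ x < S.y₂ t) := fun x t ht => by
    rw [(hy t ht).2, mem_Ioo, similarity_lt_iff hα₁.le hα₃ ht,
      lt_div_iff₀ (mul_pos two_pos (Real.sqrt_pos.2 (mul_pos hα₃ ht))), zero_mul]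
  have m₂ : ∀ x t, 0 < t → (x / (2 * √(p.α₂ * t)) ∈
      Icc (ξ₂ * √(p.α₁ / p.α₂)) (ξ₁ * √(p.α₁ / p.α₂)) ↔ S.y₂ t ≤ x ∧ x ≤ S.y₁ t) :=
    fun x t ht => by
    rw [(hy t ht).1, (hy t ht).2, mem_Icc, similarity_le_iff hα₁.le hα₂ ht,
      le_similarity_iff hα₁.le hα₂ ht]
  have m₂' : ∀ x t, 0 < t → (x / (2 * √(p.α₂ * t)) ∈
      Ioo (ξ₂ * √(p.α₁ / p.α₂)) (ξ₁ * √(p.α₁ / p.α₂)) ↔ S.y₂ t < x ∧ x < S.y₁ t) :=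
    fun x t ht => by
    rw [(hy t ht).1, (hy t ht).2, mem_Ioo, similarity_lt_iff hα₁.le hα₂ ht,
      lt_similarity_iff hα₁.le hα₂ ht]
  have hone : √(p.α₁ / p.α₁) = 1 := by rw [div_self hα₁.ne', Real.sqrt_one]
  have m₁ : ∀ x t, 0 < t → (x / (2 * √(p.α₁ * t)) ∈ Ici ξ₁ ↔ S.y₁ t ≤ x) := fun x t ht => by
    rw [(hy t ht).1, mem_Ici, ← le_similarity_iff hα₁.le hα₁ ht, hone, mul_one]
  have m₁' : ∀ x t, 0 < t → (x / (2 * √(p.α₁ * t)) ∈ Ioi ξ₁ ↔ S.y₁ t < x) := fun x t ht => by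
    rw [(hy t ht).1, mem_Ioi, ← lt_similarity_iff hα₁.le hα₁ ht, hone, mul_one]
  obtain ⟨a₃, c₃, e₃⟩ := exists_eq_erf_similarity hα₃ (Φ := S.Φ₃) isOpen_Ioo isPreconnected_Ioo
    Ioo_subset_Icc_self (closure_Ioo (mul_pos hξ₂ hb).ne).ge
    (fun x t ht hx => h₃ (x, t) ⟨ht, (m₃ x t ht).1 hx⟩)
    (hS.cont₃.mono fun z hz => ⟨hz.1, (m₃ _ _ hz.1).1 hz.2⟩)
    (hS.heat₃.mono fun z hz => ⟨hz.1, (m₃' _ _ hz.1).1 hz.2⟩)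
  obtain ⟨a₂, c₂, e₂⟩ := exists_eq_erf_similarity hα₂ (Φ := S.Φ₂) isOpen_Ioo isPreconnected_Ioo
    Ioo_subset_Icc_self (closure_Ioo (mul_lt_mul_of_pos_right hξ ha).ne).ge
    (fun x t ht hx => h₂ (x, t) ⟨ht, (m₂ x t ht).1 hx⟩)
    (hS.cont₂.mono fun z hz => ⟨hz.1, (m₂ _ _ hz.1).1 hz.2⟩)
    (hS.heat₂.mono fun z hz => ⟨hz.1, (m₂' _ _ hz.1).1 hz.2⟩)
  obtain ⟨a₁, c₁, e₁⟩ := exists_eq_erf_similarity hα₁ (Φ := S.Φ₁) isOpen_Ioi isPreconnected_Ioi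
    Ioi_subset_Ici_self (closure_Ioi ξ₁).ge
    (fun x t ht hx => h₁ (x, t) ⟨ht, (m₁ x t ht).1 hx⟩)
    (hS.cont₁.mono fun z hz => ⟨hz.1, (m₁ _ _ hz.1).1 hz.2⟩)
    (hS.heat₁.mono fun z hz => ⟨hz.1, (m₁' _ _ hz.1).1 hz.2⟩)
  -- the boundary values determine the coefficients
  obtain ⟨o2, o12⟩ := hS.ordered 1 one_pos
  obtain ⟨hy₁, hy₂⟩ := hy 1 one_pos
  have b₃ : a₃ + c₃ * erf (ξ₂ * √(p.α₁ / p.α₃)) = p.B := by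
    have := e₃ (S.y₂ 1) 1 one_pos ((m₃ _ _ one_pos).2 ⟨o2.le, le_rfl⟩)
    rw [(hS.temp_B 1 one_pos).1, hy₂, similarity_boundary hα₁.le hα₃ one_pos] at this
    exact this.symm
  have b₂ : a₂ + c₂ * erf (ξ₂ * √(p.α₁ / p.α₂)) = p.B := by
    have := e₂ (S.y₂ 1) 1 one_pos ((m₂ _ _ one_pos).2 ⟨le_rfl, o12.le⟩)
    rw [(hS.temp_B 1 one_pos).2, hy₂, similarity_boundary hα₁.le hα₂ one_pos] at this
    exact this.symm
  have b₂' : a₂ + c₂ * erf (ξ₁ * √(p.α₁ / p.α₂)) = p.C := by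
    have := e₂ (S.y₁ 1) 1 one_pos ((m₂ _ _ one_pos).2 ⟨o12.le, le_rfl⟩)
    rw [(hS.temp_C 1 one_pos).1, hy₁, similarity_boundary hα₁.le hα₂ one_pos] at this
    exact this.symm
  have b₁ : a₁ + c₁ * erf ξ₁ = p.C := by
    have := e₁ (S.y₁ 1) 1 one_pos ((m₁ _ _ one_pos).2 le_rfl)
    rw [(hS.temp_C 1 one_pos).2, hy₁, similarity_boundary hα₁.le hα₁ one_pos, hone,
      mul_one] at this
    exact this.symm
  have b₁' : a₁ + c₁ = p.D := by
    have l1 := tendsto_erf_atTop.comp (tendsto_id.atTop_div_const (mul_pos two_pos (hs 1 one_pos)))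
    have l2 := (l1.const_mul c₁).const_add a₁
    rw [mul_one c₁] at l2
    refine tendsto_nhds_unique (l2.congr' ?_) (hS.infinity_D 1 one_pos)
    filter_upwards [eventually_ge_atTop (S.y₁ 1)] with x hx
    exact (e₁ x 1 one_pos ((m₁ _ _ one_pos).2 hx)).symm
  have hΔ := (erf_sub_pos hp hξ).ne'
  have hc := (erfc_pos ξ₁).ne'
  -- The sign is reversed because `profile` subtracts the `erf` of the similarity variable.
  refine ⟨ξ₁, ξ₂, -c₃, hξ₂, hξ, fun t ht => ?_, fun z hz => ?_, fun z hz => ?_, fun z hz => ?_⟩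
  · rcases ht.eq_or_lt with rfl | ht
    · simp [profile, hS.y₁_zero, hS.y₂_zero]
    · exact ⟨(hy t ht).1.symm, (hy t ht).2.symm⟩
  · obtain ⟨ht, hx⟩ := hz
    rw [e₃ z.1 z.2 ht ((m₃ _ _ ht).2 (by rw [(hy _ ht).2]; exact hx))]
    simp only [profile]
    linear_combination -b₃
  · obtain ⟨ht, hx⟩ := hz
    rw [e₂ z.1 z.2 ht ((m₂ _ _ ht).2 (by rw [(hy _ ht).1, (hy _ ht).2]; exact hx))]
    simp only [profile]
    rw [← b₂, ← b₂']
    generalize erf (ξ₁ * √(p.α₁ / p.α₂)) = E₁ at hΔ ⊢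
    generalize erf (ξ₂ * √(p.α₁ / p.α₂)) = E₂ at hΔ ⊢
    field_simp
    ring
  · obtain ⟨ht, hx⟩ := hz
    rw [e₁ z.1 z.2 ht ((m₁ _ _ ht).2 (by rw [(hy _ ht).1]; exact hx))]
    simp only [profile]
    unfold erfc at hc ⊢
    rw [← b₁, ← b₁']
    field_simp
    ring

/-- Coincidence gives equality on closed phases only, which is enough for derivatives within the
phase. -/
theorem Candidate.Coincide.hasDerivWithinAt₃ {S S' : Candidate} (h : S.Coincide S') {t : ℝ}
    (ht : 0 < t) {a x : ℝ}
    (ha : HasDerivWithinAt (fun x => S'.Φ₃ x t) a (Icc 0 (S'.y₂ t)) x)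
    (hx : x ∈ Icc 0 (S'.y₂ t)) : HasDerivWithinAt (fun x => S.Φ₃ x t) a (Icc 0 (S'.y₂ t)) x := by
  have e : ∀ x ∈ Icc 0 (S'.y₂ t), S.Φ₃ x t = S'.Φ₃ x t := fun x hx =>
    h.2.1 (x, t) ⟨ht, hx.1, by rw [(h.1 t ht.le).2]; exact hx.2⟩
  exact ha.congr e (e x hx)

theorem Candidate.Coincide.hasDerivWithinAt₂ {S S' : Candidate} (h : S.Coincide S') {t : ℝ}
    (ht : 0 < t) {a x : ℝ}
    (ha : HasDerivWithinAt (fun x => S'.Φ₂ x t) a (Icc (S'.y₂ t) (S'.y₁ t)) x)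
    (hx : x ∈ Icc (S'.y₂ t) (S'.y₁ t)) :
    HasDerivWithinAt (fun x => S.Φ₂ x t) a (Icc (S'.y₂ t) (S'.y₁ t)) x := by
  have e : ∀ x ∈ Icc (S'.y₂ t) (S'.y₁ t), S.Φ₂ x t = S'.Φ₂ x t := fun x hx =>
    h.2.2.1 (x, t) ⟨ht, by rw [(h.1 t ht.le).2]; exact hx.1, by rw [(h.1 t ht.le).1]; exact hx.2⟩
  exact ha.congr e (e x hx)

theorem Candidate.Coincide.hasDerivWithinAt₁ {S S' : Candidate} (h : S.Coincide S') {t : ℝ}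
    (ht : 0 < t) {a x : ℝ}
    (ha : HasDerivWithinAt (fun x => S'.Φ₁ x t) a (Ici (S'.y₁ t)) x)
    (hx : x ∈ Ici (S'.y₁ t)) : HasDerivWithinAt (fun x => S.Φ₁ x t) a (Ici (S'.y₁ t)) x := by
  have e : ∀ x ∈ Ici (S'.y₁ t), S.Φ₁ x t = S'.Φ₁ x t := fun x hx =>
    h.2.2.2 (x, t) ⟨ht, by rw [(h.1 t ht.le).1]; exact hx⟩
  exact ha.congr e (e x hx)

/-- One-sided derivatives on nondegenerate intervals are unique, so the Stefan conditions at `t = 1`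
must hold with the explicit derivatives of the profile. -/
theorem isBalanced_of_coincide (hp : p.Admissible) {S : Candidate} (hS : IsStefanSolution p S)
    {ξ₁ ξ₂ g : ℝ} (hξ₂ : 0 < ξ₂) (hξ : ξ₂ < ξ₁) (h : (profile p ξ₁ ξ₂ g).Coincide S) :
    p.IsBalanced ξ₁ ξ₂ g := by
  have h1 : (0 : ℝ) < 1 := one_pos
  obtain ⟨o2, o12⟩ := hS.ordered 1 h1
  have hy₁ : S.y₁ 1 = 2 * ξ₁ * √(p.α₁ * 1) := (h.1 1 zero_le_one).1.symm
  have hy₂ : S.y₂ 1 = 2 * ξ₂ * √(p.α₁ * 1) := (h.1 1 zero_le_one).2.symm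
  have hv₁ : ∀ {v}, HasDerivAt S.y₁ v 1 → v = √p.α₁ * ξ₁ / √1 := fun hv => by
    refine hv.unique ((hasDerivAt_boundary hp.α₁_pos h1 ξ₁).congr_of_eventuallyEq ?_)
    filter_upwards [lt_mem_nhds h1] with t ht using (h.1 t ht.le).1.symm
  have hv₂ : ∀ {v}, HasDerivAt S.y₂ v 1 → v = √p.α₁ * ξ₂ / √1 := fun hv => by
    refine hv.unique ((hasDerivAt_boundary hp.α₁_pos h1 ξ₂).congr_of_eventuallyEq ?_)
    filter_upwards [lt_mem_nhds h1] with t ht using (h.1 t ht.le).2.symm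
  refine ⟨hξ₂, hξ, (outer_iff p ξ₁ ξ₂ h1).1 ?_, (inner_iff p ξ₁ ξ₂ g h1).1 ?_⟩
  · obtain ⟨a, b, v, ha, hb, hv, heq⟩ := hS.stefan₁ 1 h1
    have m : S.y₁ 1 ∈ Icc (S.y₂ 1) (S.y₁ 1) := ⟨o12.le, le_rfl⟩
    have ha' := (uniqueDiffOn_Ici _ _ self_mem_Ici).eq_deriv _
      (h.hasDerivWithinAt₁ h1 ha self_mem_Ici)
      (hy₁ ▸ hasDerivAt_profile_Φ₁ hp ξ₁ ξ₂ g h1 ξ₁).hasDerivWithinAt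
    have hb' := (uniqueDiffOn_Icc o12 _ m).eq_deriv _ (h.hasDerivWithinAt₂ h1 hb m)
      (hy₁ ▸ hasDerivAt_profile_Φ₂ hp ξ₁ ξ₂ g h1 ξ₁).hasDerivWithinAt
    rwa [ha', hb', hv₁ hv] at heq
  · obtain ⟨a, b, v, ha, hb, hv, heq⟩ := hS.stefan₂ 1 h1
    have m : S.y₂ 1 ∈ Icc (S.y₂ 1) (S.y₁ 1) := ⟨le_rfl, o12.le⟩
    have m' : S.y₂ 1 ∈ Icc 0 (S.y₂ 1) := ⟨o2.le, le_rfl⟩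
    have ha' := (uniqueDiffOn_Icc o12 _ m).eq_deriv _ (h.hasDerivWithinAt₂ h1 ha m)
      (hy₂ ▸ hasDerivAt_profile_Φ₂ hp ξ₁ ξ₂ g h1 ξ₂).hasDerivWithinAt
    have hb' := (uniqueDiffOn_Icc o2 _ m').eq_deriv _ (h.hasDerivWithinAt₃ h1 hb m')
      (hy₂ ▸ hasDerivAt_profile_Φ₃ hp ξ₁ ξ₂ g h1 ξ₂).hasDerivWithinAt
    rwa [ha', hb', hv₂ hv] at heq

/-- Every solution of similarity type is one of the profiles. -/
theorem exists_profile (hp : p.Admissible) {S : Candidate} (hS : IsStefanSolution p S)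
    (hsim : IsSimilarityType p S) :
    ∃ ξ₁ ξ₂ g, p.IsBalanced ξ₁ ξ₂ g ∧ (profile p ξ₁ ξ₂ g).Coincide S := by
  obtain ⟨ξ₁, ξ₂, g, h2, h21, hco⟩ := coincide_profile hp hS hsim
  exact ⟨ξ₁, ξ₂, g, isBalanced_of_coincide hp hS h2 h21 hco, hco⟩

theorem neumannSolution_eq (p : Data) (q l₁ l₂ : ℝ) :
    neumannSolution p q l₁ l₂ = profile p l₁ l₂ (q * √(Real.pi * p.α₃) / p.k₃) := rfl

theorem dirichletSolution_eq (hp : p.Admissible) (A : ℝ) {μ₁ μ₂ : ℝ} (h2 : 0 < μ₂)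
    (h21 : μ₂ < μ₁) :
    dirichletSolution p A μ₁ μ₂ =
      profile p μ₁ μ₂ ((A - p.B) / erf (μ₂ * √(p.α₁ / p.α₃))) := by
  have hE := (erf_pos (mul_pos h2 hp.sqrt_div₃_pos)).ne'
  have hΔ := (erf_sub_pos hp h21).ne'
  simp only [dirichletSolution, profile, Candidate.mk.injEq, and_true, true_and]
  generalize erf (μ₁ * √(p.α₁ / p.α₂)) = E₁ at hΔ ⊢
  generalize erf (μ₂ * √(p.α₁ / p.α₂)) = E₂ at hΔ ⊢
  constructor <;> funext x t <;> field_simp <;> ring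

/-- For any solution, the value at `x = 0` gives `B + g * erf (ξ₂ √(α₁/α₃)) = A`, which determines
`g`; the balance then becomes the equation that has `μ₁` as its only root. -/
theorem isTheSolution_dirichlet (hp : p.Admissible) {A μ₁ μ₂ : ℝ}
    (h : p.IsDirichletCoeff A μ₁ μ₂) :
    IsTheSolution (IsSolutionP2 p A) (dirichletSolution p A μ₁ μ₂) := by
  obtain ⟨hz, hQ, huniq, rfl⟩ := h
  have h2 := hp.inner_pos hz
  rw [dirichletSolution_eq hp A h2 (hp.inner_lt_self hz.le)]
  rw [hp.V_eq] at hQ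
  have hE := (erf_pos (mul_pos h2 hp.sqrt_div₃_pos)).ne'
  refine ⟨⟨isStefanSolution_profile hp ((hp.isBalanced_iff _ _ _).2 ⟨hz, rfl, hQ⟩),
    isSimilarityType_profile p _ _ _, fun t _ => ?_⟩, fun S ⟨hS, hsim, hA⟩ => ?_⟩
  · rw [profile_at_zero, div_mul_cancel₀ _ hE]
    ring
  · obtain ⟨ξ₁, ξ₂, g, hbal, hco⟩ := exists_profile hp hS hsim
    have hA' : p.B + g * erf (ξ₂ * √(p.α₁ / p.α₃)) = A := by
      rw [← hA 1 one_pos, ← profile_at_zero p ξ₁ ξ₂ g 1]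
      refine hco.2.1 (0, 1) ⟨one_pos, le_rfl, ?_⟩
      rw [(hco.1 1 zero_le_one).2]
      exact (hS.ordered 1 one_pos).1.le
    have hE' := (erf_pos (mul_pos hbal.pos hp.sqrt_div₃_pos)).ne'
    have hg : g = (A - p.B) / erf (ξ₂ * √(p.α₁ / p.α₃)) := by
      rw [eq_div_iff hE', ← hA']
      ring
    obtain ⟨hz', rfl, hQ'⟩ := (hp.isBalanced_iff _ _ _).1 hbal
    rw [hg, ← hp.V_eq] at hQ'
    have := huniq ξ₁ hz' hQ'
    subst this
    rwa [← hg]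

/-- Here the flux at `x = 0` determines `g` without reference to `ξ₂`, and the balance becomes the
equation with `P q`. -/
theorem isTheSolution_neumann (hp : p.Admissible) {q l₁ l₂ : ℝ}
    (h : p.IsNeumannCoeff q l₁ l₂) :
    IsTheSolution (IsSolutionP3 p q) (neumannSolution p q l₁ l₂) := by
  obtain ⟨hz, hQ, huniq, rfl⟩ := h
  rw [neumannSolution_eq]
  rw [hp.P_eq] at hQ
  have hk := hp.k₃_pos
  have hα := hp.sqrt_α₃_pos
  have hpi := sqrt_pi_pos
  refine ⟨⟨isStefanSolution_profile hp ((hp.isBalanced_iff _ _ _).2 ⟨hz, rfl, hQ⟩),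
    isSimilarityType_profile p _ _ _, fun t ht =>
      ⟨_, (hasDerivAt_profile_at_zero hp _ _ _ ht).hasDerivWithinAt, ?_⟩⟩,
    fun S ⟨hS, hsim, hA⟩ => ?_⟩
  · rw [Real.sqrt_mul Real.pi_pos.le]
    field_simp
  · obtain ⟨ξ₁, ξ₂, g, hbal, hco⟩ := exists_profile hp hS hsim
    obtain ⟨a, ha, hq⟩ := hA 1 one_pos
    have o2 := (hS.ordered 1 one_pos).1
    have m : (0 : ℝ) ∈ Icc 0 (S.y₂ 1) := ⟨le_rfl, o2.le⟩
    have ha' := (uniqueDiffOn_Icc o2 _ m).eq_deriv _ (hco.hasDerivWithinAt₃ one_pos ha m)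
      (hasDerivAt_profile_at_zero hp ξ₁ ξ₂ g one_pos).hasDerivWithinAt
    have hg : g = q * √(Real.pi * p.α₃) / p.k₃ := by
      rw [ha', Real.sqrt_one] at hq
      rw [Real.sqrt_mul Real.pi_pos.le]
      field_simp at hq ⊢
      linarith
    obtain ⟨hz', rfl, hQ'⟩ := (hp.isBalanced_iff _ _ _).1 hbal
    rw [hg, ← hp.P_eq] at hQ'
    have := huniq ξ₁ hz' hQ'
    subst this
    rwa [← hg]

theorem Candidate.Coincide.refl (S : Candidate) : S.Coincide S :=
  ⟨fun _ _ => ⟨rfl, rfl⟩, fun _ _ => rfl, fun _ _ => rfl, fun _ _ => rfl⟩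

namespace Data

/-- Coefficients of the two problems agree as soon as the data induce the same slope. -/
theorem IsDirichletCoeff.eq_of_slope_eq (hp : p.Admissible) {A q μ₁ μ₂ l₁ l₂ : ℝ}
    (hμ : p.IsDirichletCoeff A μ₁ μ₂) (hl : p.IsNeumannCoeff q l₁ l₂)
    (h : (A - p.B) / erf (l₂ * √(p.α₁ / p.α₃)) = q * √(Real.pi * p.α₃) / p.k₃) :
    μ₁ = l₁ ∧ μ₂ = l₂ := by
  obtain ⟨-, -, hu, rfl⟩ := hμ
  obtain ⟨hz, hQ, -, rfl⟩ := hl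
  rw [hp.P_eq, ← h, ← hp.V_eq] at hQ
  have := hu _ hz hQ
  exact ⟨this.symm, this ▸ rfl⟩

theorem IsNeumannCoeff.eq_of_slope_eq (hp : p.Admissible) {A q μ₁ μ₂ l₁ l₂ : ℝ}
    (hμ : p.IsDirichletCoeff A μ₁ μ₂) (hl : p.IsNeumannCoeff q l₁ l₂)
    (h : (A - p.B) / erf (μ₂ * √(p.α₁ / p.α₃)) = q * √(Real.pi * p.α₃) / p.k₃) :
    l₁ = μ₁ ∧ l₂ = μ₂ := by
  obtain ⟨hz, hQ, -, rfl⟩ := hμ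
  obtain ⟨-, -, hu, rfl⟩ := hl
  rw [hp.V_eq, h, ← hp.P_eq] at hQ
  have := hu _ hz hQ
  exact ⟨this.symm, this ▸ rfl⟩

end Data

end Profile

end Stefan

end

/-! ### Equivalence of the two problems -/

theorem theorem3p2 (p : Stefan.Data) (hp : p.Admissible) :
    -- part (a)
    (∀ q₀ : ℝ, p.q₂ < q₀ →
      ∃ l₁ l₂ : ℝ, p.IsNeumannCoeff q₀ l₁ l₂ ∧
        ∀ A : ℝ,
          A = p.B + q₀ * √(Real.pi * p.α₃) / p.k₃ * Stefan.erf (l₂ * √(p.α₁ / p.α₃)) →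
          p.B < A ∧
          ∃ μ₁ μ₂ : ℝ, p.IsDirichletCoeff A μ₁ μ₂ ∧
            Stefan.IsTheSolution (Stefan.IsSolutionP3 p q₀) (Stefan.neumannSolution p q₀ l₁ l₂) ∧
            Stefan.IsTheSolution (Stefan.IsSolutionP2 p A) (Stefan.dirichletSolution p A μ₁ μ₂) ∧
            (Stefan.dirichletSolution p A μ₁ μ₂).Coincide
              (Stefan.neumannSolution p q₀ l₁ l₂)) ∧
    -- part (b)
    (∀ A : ℝ, p.B < A →
      ∃ μ₁ μ₂ : ℝ, p.IsDirichletCoeff A μ₁ μ₂ ∧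
        (p.k₂ * (p.B - p.C) / (√p.α₂ * Stefan.erf (p.z₀ * √(p.α₁ / p.α₂))) <
            p.k₃ * (A - p.B) / (√p.α₃ * Stefan.erf (μ₂ * √(p.α₁ / p.α₃))) →
          ∀ q₀ : ℝ,
            q₀ = p.k₃ / √(Real.pi * p.α₃) * ((A - p.B) / Stefan.erf (μ₂ * √(p.α₁ / p.α₃))) →
            p.q₂ < q₀ ∧
            ∃ l₁ l₂ : ℝ, p.IsNeumannCoeff q₀ l₁ l₂ ∧
              Stefan.IsTheSolution (Stefan.IsSolutionP2 p A)
                (Stefan.dirichletSolution p A μ₁ μ₂) ∧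
              Stefan.IsTheSolution (Stefan.IsSolutionP3 p q₀)
                (Stefan.neumannSolution p q₀ l₁ l₂) ∧
              (Stefan.neumannSolution p q₀ l₁ l₂).Coincide
                (Stefan.dirichletSolution p A μ₁ μ₂))) := by
  constructor
  · intro q₀ hq₀
    obtain ⟨l₁, hl⟩ := hp.exists_isNeumannCoeff hq₀
    have hl₂ := hp.inner_pos hl.1
    have hE := Stefan.erf_pos (mul_pos hl₂ hp.sqrt_div₃_pos)
    refine ⟨l₁, p.inner l₁, hl, fun A hA => ?_⟩
    have hBA : p.B < A := by
      rw [hA]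
      exact lt_add_of_pos_right _ (mul_pos (div_pos (mul_pos (hp.q₂_pos.trans hq₀)
        (Real.sqrt_pos.2 (mul_pos Real.pi_pos hp.α₃_pos))) hp.k₃_pos) hE)
    have hslope : (A - p.B) / Stefan.erf (p.inner l₁ * √(p.α₁ / p.α₃)) =
        q₀ * √(Real.pi * p.α₃) / p.k₃ := by
      rw [div_eq_iff hE.ne', hA]
      ring
    obtain ⟨μ₁, hμ⟩ := hp.exists_isDirichletCoeff hBA
    -- Equal slopes make `l₁` a root of the Dirichlet equation, so it is `μ₁`; both candidates are
    -- then the same profile.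
    obtain ⟨rfl, -⟩ := hμ.eq_of_slope_eq hp hl hslope
    refine ⟨hBA, μ₁, p.inner μ₁, hμ, Stefan.isTheSolution_neumann hp hl,
      Stefan.isTheSolution_dirichlet hp hμ, ?_⟩
    rw [Stefan.dirichletSolution_eq hp A hl₂ (hp.inner_lt_self hl.1.le), hslope]
    exact .refl _
  · intro A hA
    obtain ⟨μ₁, hμ⟩ := hp.exists_isDirichletCoeff hA
    have hμ₂ := hp.inner_pos hμ.1
    refine ⟨μ₁, p.inner μ₁, hμ, fun hcond q₀ hq₀ => ?_⟩
    have hk := hp.k₃_pos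
    have hα := hp.sqrt_α₃_pos
    have hpi := Stefan.sqrt_pi_pos
    have hslope : (A - p.B) / Stefan.erf (p.inner μ₁ * √(p.α₁ / p.α₃)) =
        q₀ * √(Real.pi * p.α₃) / p.k₃ := by
      rw [hq₀, Real.sqrt_mul Real.pi_pos.le]
      field_simp
    have hq : p.q₂ < q₀ := by
      -- Divided by `√π`, the assumed inequality is exactly `q₂ < q₀`.
      have h := div_lt_div_of_pos_right hcond hpi
      rw [div_div, div_div, mul_right_comm, mul_right_comm √p.α₃] at h
      rwa [hq₀, Stefan.Data.q₂, Real.sqrt_mul Real.pi_pos.le, Real.sqrt_mul hp.α₂_pos.le,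
        div_mul_div_comm, mul_comm √Real.pi √p.α₃]
    obtain ⟨l₁, hl⟩ := hp.exists_isNeumannCoeff hq
    obtain ⟨rfl, -⟩ := hl.eq_of_slope_eq hp hμ hslope
    refine ⟨hq, l₁, p.inner l₁, hl, Stefan.isTheSolution_dirichlet hp hμ,
      Stefan.isTheSolution_neumann hp hl, ?_⟩
    rw [Stefan.dirichletSolution_eq hp A hμ₂ (hp.inner_lt_self hμ.1.le), hslope]
    exact .refl _
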